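/- Let $G_0,G_1,G_2,\dots$ be the Vignéras multiple gamma functions, i.e. functions holomorphic on $\mathbb C\setminus\mathbb Z_{\le 0}$, positive on $[1,\infty)$, with $G_0(z)=z$, $G_{n+1}(z+1)=G_n(z)\,G_{n+1}(z)$ for $z\in\mathbb C\setminus\mathbb Z_{\le 0}$, $G_n(1)=1$ and $\frac{d^{n+1}}{dx^{n+1}}\log G_n(x+1)\ge 0$ for real $x\ge 0$, for all $n\ge 0$. Such a sequence exists, and for $n\ge 1$ each $G_n(z+1)$ has a holomorphic logarithm $\log G_n(z+1)$ on $\mathbb C\setminus(-\infty,-1]$, normalized to be $0$ at $z=0$. Let $B_m(x)$ be the Bernoulli polynomials, $\frac{t e^{xt}}{e^t-1}=\sum_{m\ge 0}B_m(x)\frac{t^m}{m!}$, let $B_m=B_m(0)$, let $\zeta$ be the Riemann zeta function and $\log$ (of a complex number) the principal logarithm. For integers $j\ge 0$ put $$\varphi_{j,r}=\left(\frac{d}{dt}\right)^{r}\left\{\frac{t^{j+1}}{j+1}\log t-\frac{t^{j+1}}{(j+1)^2}\right\}\Bigg|_{t=1},\qquad P_j(x)=\sum_{r=0}^{j+1}\frac{B_r}{r!}\,\varphi_{j,r}\,x^{j+1-r},$$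 and define polynomials $G_{n,j}(z)$ for $n\ge 1$ by $\binom{z-u}{n-1}=\sum_{j=0}^{n-1}G_{n,j}(z)u^j$. Then for every $j\ge 0$ and every $z\in\mathbb C\setminus(-\infty,-1]$ the series in $$K_j(z)=\frac{B_{j+1}(z+1)}{j+1}\log(z+1)-\zeta'(-j)+P_j(z+1)+\sum_{k=1}^{\infty}\left[P_j(z+k+1)-P_j(z+k)+\frac{B_{j+1}(z+k+1)}{j+1}\log\left(\frac{z+k+1}{z+k}\right)\right]$$ converges absolutely, and for every integer $n\ge 1$ and every $z\in\mathbb C\setminus(-\infty,-1]$ $$\log G_n(z+1)=\sum_{j=0}^{n-1}G_{n,j}(z)K_j(z).$$ -/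

import Mathlib

/-- A *Vignéras hierarchy*: a sequence `G 0, G 1, G 2, …` of functions, each holomorphic away from
the non-positive integers, positive on `[1, ∞)`, satisfying the generalized Bohr-Mollerup
conditions. The values at the non-positive integers (where `G n` has zeros or poles) play no role,
and no condition is imposed there for `n ≥ 1`. -/
structure IsMultipleGammaHierarchy (G : ℕ → ℂ → ℂ) : Prop where
  differentiableOn : ∀ n, DifferentiableOn ℂ (G n) {z : ℂ | ∀ m : ℕ, z ≠ -(m : ℂ)}
  pos : ∀ n, ∀ x : ℝ, 0 ≤ x → ∃ r : ℝ, 0 < r ∧ G n ((x : ℂ) + 1) = (r : ℂ)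
  add_one : ∀ n, ∀ z : ℂ, (∀ m : ℕ, z ≠ -(m : ℂ)) → G (n + 1) (z + 1) = G n z * G (n + 1) z
  one : ∀ n, G n 1 = 1
  iteratedDeriv_nonneg : ∀ n, ∀ x : ℝ, 0 ≤ x →
    0 ≤ iteratedDeriv (n + 1) (fun t : ℝ => Real.log (G n ((t : ℂ) + 1)).re) x
  zero : ∀ z : ℂ, G 0 z = z

/-- `L` is the function `z ↦ log g (z + 1)`: the holomorphic branch of the logarithm on the plane
cut along `(-∞, -1]` (a star-shaped domain) that vanishes at `z = 0`. -/
structure IsLogBranch (g L : ℂ → ℂ) : Prop where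
  differentiableOn : DifferentiableOn ℂ L {z : ℂ | z + 1 ∈ Complex.slitPlane}
  exp_eq : ∀ z : ℂ, z + 1 ∈ Complex.slitPlane → Complex.exp (L z) = g (z + 1)
  zero : L 0 = 0

/-- `G_{n,j}(z)`, for `n ≥ 1`: the coefficient of `u ^ j` in the polynomial
`(z - u).choose (n - 1) = (z - u) (z - u - 1) ⋯ (z - u - n + 2) / (n - 1)!` in `u`. -/
noncomputable def binomCoeffPoly (n j : ℕ) (z : ℂ) : ℂ :=
  (Polynomial.C (((n - 1).factorial : ℂ)⁻¹) *
    (descPochhammer ℂ (n - 1)).comp (Polynomial.C z - Polynomial.X)).coeff j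

/-- The value `B_m(x)` of the Bernoulli polynomial. -/
noncomputable def bernoulliVal (m : ℕ) (x : ℂ) : ℂ :=
  Polynomial.aeval x (Polynomial.bernoulli m)

/-- `φ_{j,r}`: the `r`-th derivative of `t ^ (j+1) / (j+1) * log t - t ^ (j+1) / (j+1) ^ 2`
at `t = 1`. -/
noncomputable def phiCoeff (j r : ℕ) : ℝ :=
  iteratedDeriv r
    (fun t : ℝ => t ^ (j + 1) / ((j : ℝ) + 1) * Real.log t - t ^ (j + 1) / ((j : ℝ) + 1) ^ 2) 1

/-- The polynomial `P_j(x) = ∑_{r=0}^{j+1} B_r / r! * φ_{j,r} * x ^ (j+1-r)`, with `B_1 = -1/2`. -/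
noncomputable def polyP (j : ℕ) (x : ℂ) : ℂ :=
  ∑ r ∈ Finset.range (j + 2),
    ((bernoulli r : ℚ) : ℂ) / (r.factorial : ℂ) * (phiCoeff j r : ℂ) * x ^ (j + 1 - r)

/-- The `k`-th summand (`k ≥ 1`) of the series in `K_j(z)`. -/
noncomputable def kTerm (j : ℕ) (z : ℂ) (k : ℕ) : ℂ :=
  polyP j (z + k + 1) - polyP j (z + k) +
    bernoulliVal (j + 1) (z + k + 1) / ((j : ℂ) + 1) * Complex.log ((z + k + 1) / (z + k))

/-- The function `K_j(z)`; the series runs over the integers `k + 1 ≥ 1`. -/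
noncomputable def funK (j : ℕ) (z : ℂ) : ℂ :=
  bernoulliVal (j + 1) (z + 1) / ((j : ℂ) + 1) * Complex.log (z + 1)
    - deriv riemannZeta (-(j : ℂ)) + polyP j (z + 1) + ∑' k : ℕ, kTerm j z (k + 1)

open Complex Filter Finset Topology
open scoped Nat

/-!
By the Euler–Maclaurin formula the summands of `K_j` are `O(k⁻²)`, and the resulting function solves
`K_j(z + 1) - K_j(z) = (z + 1) ^ j * log (z + 1)`. A second application of Euler–Maclaurin, to the
Hurwitz series of `ζ'(-j)`, gives `K_j(0) = 0`. By Pascal's rule `L_n = ∑ j, G_{n,j} K_j` therefore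
satisfies `L_{n+1}(z + 1) = L_{n+1}(z) + L_n(z)` and `L_n(0) = 0`.

In the right half-plane `L_n` grows like `|z| ^ n` up to logarithms, so Cauchy's estimates make its
derivatives of order greater than `n` tend to `0` along the positive axis. Summing the functional
equation of these derivatives up to infinity shows that they have alternating signs, and `exp L_n`
continues to a multiple gamma function. Conversely the logarithm of a multiple gamma function on the
positive axis differs from `L_n` by a periodic function one of whose derivatives is bounded below by
a function tending to `0`, and such a periodic function is constant.
-/

/-! ### Euler–Maclaurin summation on a unit interval -/

theorem iteratedDerivWithin_eqOn_of_hasDerivWithinAt {E : Type*} [NormedAddCommGroup E]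
    [NormedSpace ℝ E] {s : Set ℝ} (hs : UniqueDiffOn ℝ s) {F : ℕ → ℝ → E}
    (hF : ∀ r, ∀ t ∈ s, HasDerivWithinAt (F r) (F (r + 1) t) s t) (r : ℕ) :
    Set.EqOn (iteratedDerivWithin r (F 0) s) (F r) s := by
  induction r with
  | zero => exact fun t _ => by rw [iteratedDerivWithin_zero]
  | succ r ih =>
    intro t ht
    rw [iteratedDerivWithin_succ, derivWithin_congr ih (ih ht)]
    exact (hF r t ht).derivWithin (hs t ht)

theorem norm_sub_sum_taylor_le {E : Type*} [NormedAddCommGroup E] [NormedSpace ℝ E]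
    {F : ℕ → ℝ → E}
    (hF : ∀ r, ∀ t ∈ Set.Icc (0 : ℝ) 1, HasDerivWithinAt (F r) (F (r + 1) t) (Set.Icc 0 1) t)
    {C : ℝ} (n : ℕ) (hC : ∀ t ∈ Set.Icc (0 : ℝ) 1, ‖F (n + 1) t‖ ≤ C) :
    ‖F 0 1 - ∑ k ∈ range (n + 1), (k ! : ℝ)⁻¹ • F k 0‖ ≤ C := by
  have hunique := uniqueDiffOn_Icc (zero_lt_one' ℝ)
  have hderiv := iteratedDerivWithin_eqOn_of_hasDerivWithinAt hunique hF
  have hsmooth : ContDiffOn ℝ (n + 1 : ℕ) (F 0) (Set.Icc 0 1) :=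
    contDiffOn_of_differentiableOn_deriv fun m _ t ht =>
      (hF m t ht).differentiableWithinAt.congr (hderiv m) (hderiv m ht)
  have hC0 : 0 ≤ C := (norm_nonneg _).trans (hC 0 (by simp))
  have htaylor := taylor_mean_remainder_bound zero_le_one hsmooth
    (Set.right_mem_Icc.2 zero_le_one) fun t ht => (hderiv (n + 1) ht).symm ▸ hC t ht
  simp only [taylor_within_apply, sub_zero, one_pow, mul_one,
    fun k => hderiv k (Set.left_mem_Icc.2 zero_le_one)] at htaylor
  exact htaylor.trans (div_le_self hC0 (mod_cast n.factorial_pos))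

theorem sum_bernoulli_div_factorial (m : ℕ) :
    ∑ k ∈ range (m + 1), bernoulli k / (k ! * (m - k + 1)!) = if m = 0 then 1 else 0 := by
  have hchoose : ∀ k ∈ range (m + 1),
      bernoulli k / (k ! * (m - k + 1)!) = (m + 1).choose k * bernoulli k / (m + 1)! := by
    intro k hk
    have hkm : k ≤ m := mem_range_succ_iff.1 hk
    rw [Nat.cast_choose ℚ (hkm.trans m.le_succ), Nat.succ_sub hkm]
    field_simp
  rw [sum_congr rfl hchoose, ← sum_div, sum_bernoulli]
  split_ifs <;> simp_all

/-- The constant in the Euler–Maclaurin error estimate `norm_eulerMaclaurinError_le`. -/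
noncomputable def eulerMaclaurinConst (M : ℕ) : ℝ :=
  ∑ r ∈ range (M + 1), ‖(bernoulli r / r ! : ℂ)‖

theorem eulerMaclaurinConst_nonneg (M : ℕ) : 0 ≤ eulerMaclaurinConst M :=
  sum_nonneg fun _ _ => norm_nonneg _

/-- The Euler–Maclaurin expansion of order `M` of the indefinite sum of `F 1`, where `F (r + 1)` is
meant to be the derivative of `F r` for all `r`. -/
noncomputable def eulerMaclaurinSum (F : ℕ → ℂ → ℂ) (M : ℕ) (x : ℂ) : ℂ :=
  ∑ r ∈ range (M + 1), bernoulli r / r ! * F r x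

/-- The error made on the unit interval `[x, x + 1]` when `F 1 x` is replaced by the increment of
its Euler–Maclaurin expansion. -/
noncomputable def eulerMaclaurinError (F : ℕ → ℂ → ℂ) (M : ℕ) (x : ℂ) : ℂ :=
  eulerMaclaurinSum F M (x + 1) - eulerMaclaurinSum F M x - F 1 x

theorem sum_bernoulli_mul_sum_div_factorial (a : ℕ → ℂ) (M : ℕ) :
    ∑ r ∈ range (M + 1), (bernoulli r / r ! : ℂ) *
      ∑ i ∈ range (M + 1 - r), a (r + i) / (i + 1)! = a 0 := by
  have hdiag (m : ℕ) : ∑ k ∈ range (m + 1),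
      (bernoulli k / k ! : ℂ) * (a (k + (m - k)) / (m - k + 1)!) = if m = 0 then a m else 0 := by
    calc ∑ k ∈ range (m + 1), (bernoulli k / k ! : ℂ) * (a (k + (m - k)) / (m - k + 1)!)
        = (∑ k ∈ range (m + 1), bernoulli k / (k ! * (m - k + 1)!) : ℚ) * a m := by
          push_cast
          rw [sum_mul]
          refine sum_congr rfl fun k hk => ?_
          rw [Nat.add_sub_cancel' (mem_range_succ_iff.1 hk)]
          ring
      _ = if m = 0 then a m else 0 := by
          rw [sum_bernoulli_div_factorial]
          split_ifs <;> simp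
  simp_rw [mul_sum]
  rw [← sum_range_diag_flip, sum_congr rfl fun m _ => hdiag m]
  simp

theorem norm_eulerMaclaurinError_le {F : ℕ → ℂ → ℂ} {x : ℂ}
    (hF : ∀ r, ∀ t ∈ Set.Icc (0 : ℝ) 1, HasDerivAt (F r) (F (r + 1) (x + t)) (x + t))
    {C : ℝ} (M : ℕ) (hC : ∀ t ∈ Set.Icc (0 : ℝ) 1, ‖F (M + 2) (x + t)‖ ≤ C) :
    ‖eulerMaclaurinError F M x‖ ≤ eulerMaclaurinConst M * C := by
  have hFx (r : ℕ) (t : ℝ) (ht : t ∈ Set.Icc (0 : ℝ) 1) :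
      HasDerivWithinAt (fun t : ℝ => F r (x + t)) (F (r + 1) (x + t)) (Set.Icc 0 1) t := by
    simpa [Function.comp_def] using
      ((hF r t ht).scomp t ((hasDerivAt_id t).ofReal_comp.const_add x)).hasDerivWithinAt
  have hsum : eulerMaclaurinError F M x = ∑ r ∈ range (M + 1), (bernoulli r / r ! : ℂ) *
      (F r (x + 1) - F r x - ∑ i ∈ range (M + 1 - r), F (r + i + 1) x / (i + 1)!) := by
    simp_rw [mul_sub, sum_sub_distrib]
    rw [sum_bernoulli_mul_sum_div_factorial fun r => F (r + 1) x]
    rfl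
  rw [hsum, eulerMaclaurinConst, sum_mul]
  refine norm_sum_le_of_le _ fun r hr => ?_
  rw [norm_mul]
  refine mul_le_mul_of_nonneg_left ?_ (norm_nonneg _)
  have hrM : r + (M + 1 - r) = M + 1 := Nat.add_sub_cancel' (mem_range.1 hr).le
  have htaylor := norm_sub_sum_taylor_le (F := fun i t => F (r + i) (x + t))
    (fun i => hFx (r + i)) (M + 1 - r)
    fun t ht => by simpa only [← add_assoc, hrM] using hC t ht
  rw [sum_range_succ'] at htaylor
  simpa [sub_sub, add_comm, add_assoc, div_eq_inv_mul] using htaylor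

theorem sum_eulerMaclaurinError (F : ℕ → ℂ → ℂ) (M : ℕ) (x : ℂ) (N : ℕ) :
    ∑ k ∈ range N, eulerMaclaurinError F M (k + x) =
      eulerMaclaurinSum F M (N + x) - eulerMaclaurinSum F M x - ∑ k ∈ range N, F 1 (k + x) := by
  have htelescope := sum_range_sub (fun k : ℕ => eulerMaclaurinSum F M (k + x)) N
  rw [Nat.cast_zero, zero_add] at htelescope
  simp only [eulerMaclaurinError, sum_sub_distrib, ← htelescope, Nat.cast_succ, add_right_comm]

/-! ### The antiderivatives of `x ^ j * log x` -/

theorem add_ofReal_mem_slitPlane {x : ℂ} (hx : x ∈ slitPlane) {t : ℝ} (ht : 0 ≤ t) :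
    x + t ∈ slitPlane := by
  rw [mem_slitPlane_iff] at hx ⊢
  rw [add_re, add_im, ofReal_re, ofReal_im, add_zero]
  exact hx.imp_left fun h => by linarith

theorem add_natCast_mem_slitPlane {x : ℂ} (hx : x ∈ slitPlane) (n : ℕ) : x + n ∈ slitPlane :=
  mod_cast add_ofReal_mem_slitPlane hx n.cast_nonneg

theorem add_one_mem_slitPlane {x : ℂ} (hx : x ∈ slitPlane) : x + 1 ∈ slitPlane :=
  mod_cast add_natCast_mem_slitPlane hx 1

theorem mem_slitPlane_of_re_pos {x : ℂ} (hx : 0 < x.re) : x ∈ slitPlane := Or.inl hx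

theorem natCast_add_one_mem_slitPlane (k : ℕ) : (k : ℂ) + 1 ∈ slitPlane :=
  mem_slitPlane_of_re_pos (by simpa using k.cast_add_one_pos)

theorem log_add_one_div {x : ℂ} (hx : x ∈ slitPlane) :
    log ((x + 1) / x) = log (x + 1) - log x := by
  have hx1 := add_one_mem_slitPlane hx
  have hpi : x.arg ≠ Real.pi := slitPlane_arg_ne_pi hx
  rw [div_eq_mul_inv, log_mul (slitPlane_ne_zero hx1) (inv_ne_zero (slitPlane_ne_zero hx)),
    log_inv _ hpi, sub_eq_add_neg]
  rw [arg_inv, if_neg hpi]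
  -- `x` and `x + 1` lie on the same side of the real axis, so their arguments have the same sign.
  have hle := arg_le_pi (x + 1)
  have hgt := neg_pi_lt_arg (x + 1)
  have hgt' := neg_pi_lt_arg x
  have hlt' := (arg_le_pi x).lt_of_ne hpi
  rcases le_or_gt 0 x.im with him | him
  · have harg : 0 ≤ x.arg := arg_nonneg_iff.2 him
    have harg1 : 0 ≤ (x + 1).arg := arg_nonneg_iff.2 (by simpa using him)
    constructor <;> linarith
  · have harg : x.arg < 0 := arg_neg_iff.2 him
    have harg1 : (x + 1).arg < 0 := arg_neg_iff.2 (by simpa using him)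
    constructor <;> linarith

/-- The coefficient of `x ^ (j + 1 - r) * log x` in the `r`-th derivative of
`x ^ (j + 1) * log x / (j + 1) - x ^ (j + 1) / (j + 1) ^ 2`. -/
noncomputable def powLogCoeff (j : ℕ) : ℕ → ℝ
  | 0 => 1 / ((j : ℝ) + 1)
  | r + 1 => powLogCoeff j r * ((j : ℝ) + 1 - r)

/-- The coefficient of `x ^ (j + 1 - r)`, without logarithm, in the `r`-th derivative of
`x ^ (j + 1) * log x / (j + 1) - x ^ (j + 1) / (j + 1) ^ 2`. -/
noncomputable def powLogConst (j : ℕ) : ℕ → ℝ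
  | 0 => -1 / ((j : ℝ) + 1) ^ 2
  | r + 1 => powLogConst j r * ((j : ℝ) + 1 - r) + powLogCoeff j r

/-- The `r`-th derivative of `x ^ (j + 1) * log x / (j + 1) - x ^ (j + 1) / (j + 1) ^ 2`, the
antiderivative of `x ^ j * log x` from which `φ_{j,r}` is built. -/
noncomputable def powLogDeriv (j r : ℕ) (x : ℂ) : ℂ :=
  x ^ ((j : ℤ) + 1 - r) * (powLogCoeff j r * log x + powLogConst j r)

theorem powLogCoeff_eq_descFactorial (j r : ℕ) :
    powLogCoeff j r = (j + 1).descFactorial r / ((j : ℝ) + 1) := by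
  induction r with
  | zero => simp [powLogCoeff]
  | succ r ih =>
    rw [powLogCoeff, ih, Nat.descFactorial_succ]
    rcases le_or_gt r (j + 1) with hr | hr
    · push_cast [Nat.cast_sub hr]
      ring
    · simp [Nat.descFactorial_of_lt hr]

theorem powLogCoeff_of_lt {j r : ℕ} (hr : j + 1 < r) : powLogCoeff j r = 0 := by
  simp [powLogCoeff_eq_descFactorial, Nat.descFactorial_of_lt hr]

theorem hasDerivAt_powLogDeriv (j r : ℕ) {x : ℂ} (hx : x ∈ slitPlane) :
    HasDerivAt (powLogDeriv j r) (powLogDeriv j (r + 1) x) x := by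
  have hx0 := slitPlane_ne_zero hx
  have hmul := (hasDerivAt_zpow ((j : ℤ) + 1 - r) x (Or.inl hx0)).fun_mul
    (((hasDerivAt_log hx).const_mul (powLogCoeff j r : ℂ)).add_const (powLogConst j r : ℂ))
  have hpow : x ^ ((j : ℤ) + 1 - r) = x ^ ((j : ℤ) + 1 - r - 1) * x := by
    rw [← zpow_add_one₀ hx0, sub_add_cancel]
  refine hmul.congr_deriv ?_
  rw [powLogDeriv, Nat.cast_succ, ← sub_sub, powLogCoeff, powLogConst, hpow]
  push_cast
  field_simp
  ring

theorem differentiableAt_powLogDeriv (j r : ℕ) {x : ℂ} (hx : x ∈ slitPlane) :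
    DifferentiableAt ℂ (powLogDeriv j r) x :=
  (hasDerivAt_powLogDeriv j r hx).differentiableAt

theorem powLogDeriv_one (j : ℕ) (x : ℂ) : powLogDeriv j 1 x = x ^ j * log x := by
  have hj : (j : ℝ) + 1 ≠ 0 := j.cast_add_one_ne_zero
  have hcoeff : powLogCoeff j 1 = 1 := by
    rw [powLogCoeff, powLogCoeff]
    field_simp
    simp
  have hconst : powLogConst j 1 = 0 := by
    rw [powLogConst, powLogConst, powLogCoeff]
    field_simp
    simp
  simp [powLogDeriv, hcoeff, hconst]

theorem powLogDeriv_eq_pow {j r : ℕ} (hr : r ≤ j + 1) (x : ℂ) :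
    powLogDeriv j r x = x ^ (j + 1 - r) * (powLogCoeff j r * log x + powLogConst j r) := by
  rw [powLogDeriv, ← zpow_natCast, Nat.cast_sub hr, Nat.cast_succ]

theorem powLogDeriv_zero_ofReal (j : ℕ) {t : ℝ} (ht : 0 ≤ t) : powLogDeriv j 0 t =
    (t ^ (j + 1) / ((j : ℝ) + 1) * Real.log t - t ^ (j + 1) / ((j : ℝ) + 1) ^ 2 : ℝ) := by
  rw [powLogDeriv_eq_pow (Nat.zero_le _), powLogCoeff, powLogConst, ← ofReal_log ht, tsub_zero]
  push_cast
  ring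

theorem phiCoeff_eq_powLogConst (j r : ℕ) : phiCoeff j r = powLogConst j r := by
  have hderiv : ∀ r, ∀ t ∈ Set.Ioi (0 : ℝ), HasDerivWithinAt
      (fun t : ℝ => (powLogDeriv j r t).re) (powLogDeriv j (r + 1) t).re (Set.Ioi 0) t :=
    fun r t ht => (hasDerivAt_powLogDeriv j r
      (ofReal_mem_slitPlane.2 ht)).real_of_complex.hasDerivWithinAt
  have hzero : Set.EqOn (fun t : ℝ => t ^ (j + 1) / ((j : ℝ) + 1) * Real.log t -
      t ^ (j + 1) / ((j : ℝ) + 1) ^ 2) (fun t : ℝ => (powLogDeriv j 0 t).re) (Set.Ioi 0) :=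
    fun t ht => (congrArg re (powLogDeriv_zero_ofReal j (le_of_lt ht))).symm
  have hone : (1 : ℝ) ∈ Set.Ioi 0 := Set.mem_Ioi.2 one_pos
  rw [phiCoeff, ← iteratedDerivWithin_of_isOpen isOpen_Ioi hone,
    iteratedDerivWithin_congr hzero hone,
    iteratedDerivWithin_eqOn_of_hasDerivWithinAt (uniqueDiffOn_Ioi 0) hderiv r hone]
  simp [powLogDeriv]

theorem bernoulliVal_div_eq_sum (j : ℕ) (x : ℂ) : bernoulliVal (j + 1) x / ((j : ℂ) + 1) =
    ∑ r ∈ range (j + 2), bernoulli r / r ! * powLogCoeff j r * x ^ (j + 1 - r) := by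
  rw [bernoulliVal, Polynomial.bernoulli, map_sum, sum_div]
  refine sum_congr rfl fun r _ => ?_
  rw [powLogCoeff_eq_descFactorial, Nat.descFactorial_eq_factorial_mul_choose]
  have hr : (r ! : ℂ) ≠ 0 := mod_cast r.factorial_ne_zero
  simp only [Polynomial.aeval_monomial, eq_ratCast]
  push_cast
  field_simp

theorem eulerMaclaurinSum_powLogDeriv (j : ℕ) (x : ℂ) :
    eulerMaclaurinSum (powLogDeriv j) (j + 1) x =
      bernoulliVal (j + 1) x / ((j : ℂ) + 1) * log x + polyP j x := by
  rw [bernoulliVal_div_eq_sum, polyP, eulerMaclaurinSum, sum_mul, ← sum_add_distrib]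
  refine sum_congr rfl fun r hr => ?_
  rw [phiCoeff_eq_powLogConst, powLogDeriv_eq_pow (mem_range_succ_iff.1 hr)]
  ring

theorem bernoulliVal_add_one_div (j : ℕ) (x : ℂ) :
    bernoulliVal (j + 1) (x + 1) / ((j : ℂ) + 1) =
      bernoulliVal (j + 1) x / ((j : ℂ) + 1) + x ^ j := by
  have hcomp := congrArg (Polynomial.aeval x) (Polynomial.bernoulli_comp_one_add_X (j + 1))
  have hj : (j : ℂ) + 1 ≠ 0 := j.cast_add_one_ne_zero
  simp only [Polynomial.aeval_comp, map_add, map_one, Polynomial.aeval_X, nsmul_eq_mul, map_mul,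
    map_natCast, map_pow, Nat.add_sub_cancel, Nat.cast_succ] at hcomp
  rw [bernoulliVal, bernoulliVal, add_comm x 1, hcomp]
  field_simp

theorem kTerm_eq_eulerMaclaurinError (j : ℕ) {z : ℂ} {k : ℕ} (hz : z + k ∈ slitPlane) :
    kTerm j z k = eulerMaclaurinError (powLogDeriv j) (j + 1) (z + k) := by
  rw [kTerm, eulerMaclaurinError, eulerMaclaurinSum_powLogDeriv, eulerMaclaurinSum_powLogDeriv,
    log_add_one_div hz, bernoulliVal_add_one_div, powLogDeriv_one]
  ring

theorem norm_powLogDeriv_le (j : ℕ) {x : ℂ} {a : ℝ} (ha : 0 < a) (hx : a ≤ x.re) :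
    ‖powLogDeriv j (j + 3) x‖ ≤ |powLogConst j (j + 3)| / a ^ 2 := by
  have hexp : (j : ℤ) + 1 - (j + 3 : ℕ) = -(2 : ℕ) := by push_cast; ring
  rw [powLogDeriv, hexp, powLogCoeff_of_lt (by lia), ofReal_zero, zero_mul, zero_add, norm_mul,
    zpow_neg, zpow_natCast, norm_inv, norm_pow, norm_real, Real.norm_eq_abs, inv_mul_eq_div]
  gcongr
  exact hx.trans (re_le_norm x)

theorem norm_eulerMaclaurinError_powLogDeriv_le (j : ℕ) {x : ℂ} (hx : 0 < x.re) :
    ‖eulerMaclaurinError (powLogDeriv j) (j + 1) x‖ ≤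
      eulerMaclaurinConst (j + 1) * (|powLogConst j (j + 3)| / x.re ^ 2) :=
  norm_eulerMaclaurinError_le
    (fun r _ ht => hasDerivAt_powLogDeriv j r
      (add_ofReal_mem_slitPlane (mem_slitPlane_of_re_pos hx) ht.1)) (j + 1)
    fun t ht => norm_powLogDeriv_le j hx (by simpa using ht.1)

/-! ### The functions `K_j` -/

theorem exists_summable_bound_kTerm (j : ℕ) : ∃ u : ℕ → ℝ, Summable u ∧
    ∀ z : ℂ, 0 ≤ z.re → ∀ k, ‖kTerm j z (k + 1)‖ ≤ u k := by
  refine ⟨fun k => eulerMaclaurinConst (j + 1) * (|powLogConst j (j + 3)| / ((k : ℝ) + 1) ^ 2),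
    Summable.mul_left _ ?_, fun z hz k => ?_⟩
  · simpa [div_eq_mul_inv] using
      ((summable_nat_add_iff 1).2 (Real.summable_nat_pow_inv.2 one_lt_two)).mul_left
        |powLogConst j (j + 3)|
  · have hre : (k : ℝ) + 1 ≤ (z + (k + 1 : ℕ)).re := by simpa using hz
    have hpos : 0 < (z + (k + 1 : ℕ)).re := k.cast_add_one_pos.trans_le hre
    rw [kTerm_eq_eulerMaclaurinError j (mem_slitPlane_of_re_pos hpos)]
    refine (norm_eulerMaclaurinError_powLogDeriv_le j hpos).trans ?_
    exact mul_le_mul_of_nonneg_left (by gcongr) (eulerMaclaurinConst_nonneg _)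

theorem kTerm_add_natCast (j : ℕ) (z : ℂ) (N k : ℕ) :
    kTerm j (z + N) k = kTerm j z (k + N) := by
  simp only [kTerm, Nat.cast_add, add_comm (k : ℂ) N, ← add_assoc]

theorem exists_nat_re_add_pos (z : ℂ) : ∃ N : ℕ, 0 < (z + N).re := by
  obtain ⟨N, hN⟩ := exists_nat_gt (-z.re)
  exact ⟨N, by simpa using neg_lt_iff_pos_add'.1 hN⟩

theorem summable_norm_kTerm (j : ℕ) (z : ℂ) : Summable fun k : ℕ => ‖kTerm j z (k + 1)‖ := by
  obtain ⟨N, hN⟩ := exists_nat_re_add_pos z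
  obtain ⟨u, hu, hle⟩ := exists_summable_bound_kTerm j
  rw [← summable_nat_add_iff N]
  refine Summable.of_nonneg_of_le (fun _ => norm_nonneg _) (fun k => ?_) hu
  rw [add_right_comm, ← kTerm_add_natCast]
  exact hle _ hN.le k

theorem funK_eq (j : ℕ) (z : ℂ) : funK j z =
    eulerMaclaurinSum (powLogDeriv j) (j + 1) (z + 1) - deriv riemannZeta (-(j : ℂ)) +
      ∑' k : ℕ, kTerm j z (k + 1) := by
  rw [funK, eulerMaclaurinSum_powLogDeriv]
  ring

theorem funK_add_one (j : ℕ) {z : ℂ} (hz : z + 1 ∈ slitPlane) :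
    funK j (z + 1) = funK j z + (z + 1) ^ j * log (z + 1) := by
  have htsum : ∑' k : ℕ, kTerm j z (k + 1) =
      kTerm j z 1 + ∑' k : ℕ, kTerm j (z + 1) (k + 1) := by
    rw [(summable_norm_kTerm j z).of_norm.tsum_eq_zero_add]
    exact congrArg _ (tsum_congr fun k => by simpa using (kTerm_add_natCast j z 1 (k + 1)).symm)
  rw [funK_eq, funK_eq, htsum, kTerm_eq_eulerMaclaurinError j (by simpa using hz),
    eulerMaclaurinError, Nat.cast_one, powLogDeriv_one]
  ring

theorem funK_add_natCast (j : ℕ) {z : ℂ} (hz : z + 1 ∈ slitPlane) (N : ℕ) :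
    funK j (z + N) = funK j z + ∑ i ∈ range N, (z + 1 + i) ^ j * log (z + 1 + i) := by
  induction N with
  | zero => simp
  | succ N ih =>
    have hzN : z + N + 1 ∈ slitPlane := by
      simpa only [add_right_comm] using add_natCast_mem_slitPlane hz N
    rw [Nat.cast_succ, ← add_assoc, funK_add_one j hzN, ih, sum_range_succ, add_assoc,
      add_right_comm z]

theorem isOpen_add_one_mem_slitPlane : IsOpen {z : ℂ | z + 1 ∈ slitPlane} :=
  isOpen_slitPlane.preimage (continuous_add_const 1)

theorem differentiableAt_eulerMaclaurinSum_powLogDeriv (j M : ℕ) {x : ℂ} (hx : x ∈ slitPlane) :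
    DifferentiableAt ℂ (eulerMaclaurinSum (powLogDeriv j) M) x :=
  DifferentiableAt.fun_sum fun r _ => (differentiableAt_powLogDeriv j r hx).const_mul _

theorem differentiableAt_eulerMaclaurinError_powLogDeriv (j M : ℕ) {x : ℂ} (hx : x ∈ slitPlane) :
    DifferentiableAt ℂ (eulerMaclaurinError (powLogDeriv j) M) x :=
  ((differentiableAt_comp_add_const.2
    (differentiableAt_eulerMaclaurinSum_powLogDeriv j M (add_one_mem_slitPlane hx))).sub
      (differentiableAt_eulerMaclaurinSum_powLogDeriv j M hx)).sub
        (differentiableAt_powLogDeriv j 1 hx)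

theorem differentiableAt_funK_of_re_pos (j : ℕ) {z : ℂ} (hz : 0 < z.re) :
    DifferentiableAt ℂ (funK j) z := by
  obtain ⟨u, hu, hle⟩ := exists_summable_bound_kTerm j
  have hopen : IsOpen {w : ℂ | 0 < w.re} := isOpen_lt continuous_const continuous_re
  have hmem (k : ℕ) {w : ℂ} (hw : 0 < w.re) : w + (k + 1 : ℕ) ∈ slitPlane :=
    add_natCast_mem_slitPlane (mem_slitPlane_of_re_pos hw) _
  have hterm (k : ℕ) :
      DifferentiableOn ℂ (fun w => kTerm j w (k + 1)) {w : ℂ | 0 < w.re} := fun w hw =>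
    (differentiableAt_comp_add_const.2 (differentiableAt_eulerMaclaurinError_powLogDeriv j (j + 1)
      (hmem k hw))).differentiableWithinAt.congr
        (fun v hv => kTerm_eq_eulerMaclaurinError j (hmem k hv))
        (kTerm_eq_eulerMaclaurinError j (hmem k hw))
  have htsum := (differentiableOn_tsum_of_summable_norm hu hterm hopen
    fun k w (hw : 0 < w.re) => hle w hw.le k).differentiableAt (hopen.mem_nhds hz)
  have hsum := differentiableAt_comp_add_const.2
    (differentiableAt_eulerMaclaurinSum_powLogDeriv j (j + 1)
      (add_one_mem_slitPlane (mem_slitPlane_of_re_pos hz)))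
  rw [funext (funK_eq j)]
  exact (hsum.sub_const _).add htsum

theorem differentiableOn_funK (j : ℕ) :
    DifferentiableOn ℂ (funK j) {z : ℂ | z + 1 ∈ slitPlane} := by
  intro z hz
  obtain ⟨N, hN⟩ := exists_nat_re_add_pos z
  have hshift : funK j =ᶠ[𝓝 z] fun z =>
      funK j (z + N) - ∑ i ∈ range N, (z + 1 + i) ^ j * log (z + 1 + i) := by
    filter_upwards [isOpen_add_one_mem_slitPlane.mem_nhds hz] with w hw
    exact eq_sub_of_add_eq (funK_add_natCast j hw N).symm
  refine DifferentiableAt.differentiableWithinAt (.congr_of_eventuallyEq ?_ hshift)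
  refine (differentiableAt_comp_add_const.2 (differentiableAt_funK_of_re_pos j hN)).sub
    (.fun_sum fun i _ => ?_)
  exact .mul (by fun_prop) (.clog (by fun_prop) (add_natCast_mem_slitPlane hz i))

/-! ### The derivative of the zeta function at `-j` -/

/-- The coefficient of `x ^ (1 - s - r)` in the `r`-th derivative of `x ^ (1 - s) / (s - 1)`. -/
noncomputable def cpowCoeff (s : ℂ) : ℕ → ℂ
  | 0 => (s - 1)⁻¹
  | r + 1 => cpowCoeff s r * (1 - s - r)

/-- The `r`-th derivative in `x` of `x ^ (1 - s) / (s - 1)`, an antiderivative of `-x ^ (-s)`. The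
sign makes the derivative in `s` at `s = -j` equal to `powLogDeriv j r x`. -/
noncomputable def cpowDeriv (s : ℂ) (r : ℕ) (x : ℂ) : ℂ := cpowCoeff s r * x ^ (1 - s - r)

theorem cpowCoeff_one {s : ℂ} (hs : s ≠ 1) : cpowCoeff s 1 = -1 := by
  have hs1 : s - 1 ≠ 0 := sub_ne_zero.2 hs
  rw [cpowCoeff, cpowCoeff, Nat.cast_zero, sub_zero]
  field_simp
  ring

theorem cpowDeriv_one {s : ℂ} (hs : s ≠ 1) (x : ℂ) : cpowDeriv s 1 x = -x ^ (-s) := by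
  rw [cpowDeriv, cpowCoeff_one hs, Nat.cast_one, sub_right_comm, sub_self, zero_sub, neg_one_mul]

theorem hasDerivAt_cpowDeriv (s : ℂ) (r : ℕ) {x : ℂ} (hx : x ∈ slitPlane) :
    HasDerivAt (cpowDeriv s r) (cpowDeriv s (r + 1) x) x := by
  refine (((hasDerivAt_id x).cpow_const (c := 1 - s - r) hx).const_mul
    (cpowCoeff s r)).congr_deriv ?_
  rw [cpowDeriv, cpowCoeff, Nat.cast_succ, ← sub_sub, id]
  ring

theorem cpowCoeff_neg_natCast (j r : ℕ) : cpowCoeff (-(j : ℂ)) r = -(powLogCoeff j r : ℂ) := by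
  induction r with
  | zero =>
    rw [cpowCoeff, powLogCoeff, ← neg_add', inv_neg]
    push_cast
    rw [one_div]
  | succ r ih =>
    rw [cpowCoeff, powLogCoeff, ih]
    push_cast
    ring

theorem hasDerivAt_cpowCoeff (j r : ℕ) :
    HasDerivAt (fun s => cpowCoeff s r) (powLogConst j r : ℂ) (-(j : ℂ)) := by
  induction r with
  | zero =>
    have hj : -(j : ℂ) - 1 ≠ 0 := by
      rw [← neg_add', neg_ne_zero]
      exact j.cast_add_one_ne_zero
    refine (((hasDerivAt_id (-(j : ℂ))).sub_const 1).inv hj).congr_deriv ?_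
    rw [powLogConst, id, ← neg_add', neg_sq]
    push_cast
    rfl
  | succ r ih =>
    refine (ih.mul (((hasDerivAt_id (-(j : ℂ))).const_sub 1).sub_const (r : ℂ))).congr_deriv ?_
    rw [cpowCoeff_neg_natCast, powLogConst, id]
    push_cast
    ring

theorem hasDerivAt_cpowDeriv_neg_natCast (j r : ℕ) {x : ℂ} (hx : x ≠ 0) :
    HasDerivAt (fun s => cpowDeriv s r x) (powLogDeriv j r x) (-(j : ℂ)) := by
  have hexponent : HasDerivAt (fun s : ℂ => 1 - s - r) (-1) (-(j : ℂ)) :=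
    ((hasDerivAt_id (-(j : ℂ))).const_sub 1).sub_const (r : ℂ)
  have hpow : x ^ (1 - -(j : ℂ) - r) = x ^ ((j : ℤ) + 1 - r) := by
    rw [← cpow_intCast]
    push_cast
    ring_nf
  refine ((hasDerivAt_cpowCoeff j r).mul
    (hexponent.const_cpow (c := x) (Or.inl hx))).congr_deriv ?_
  rw [cpowCoeff_neg_natCast, hpow, powLogDeriv]
  ring

theorem differentiableAt_cpowCoeff {s : ℂ} (hs : s ≠ 1) (r : ℕ) :
    DifferentiableAt ℂ (fun s => cpowCoeff s r) s := by
  induction r with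
  | zero => exact DifferentiableAt.inv (by fun_prop) (sub_ne_zero.2 hs)
  | succ r ih => exact ih.mul (by fun_prop)

theorem differentiableAt_cpowDeriv {s : ℂ} (hs : s ≠ 1) (r : ℕ) {x : ℂ} (hx : x ≠ 0) :
    DifferentiableAt ℂ (fun s => cpowDeriv s r x) s :=
  (differentiableAt_cpowCoeff hs r).mul (.const_cpow (by fun_prop) (Or.inl hx))

theorem differentiableAt_eulerMaclaurinSum_cpowDeriv {s : ℂ} (hs : s ≠ 1) (M : ℕ) {x : ℂ}
    (hx : x ≠ 0) : DifferentiableAt ℂ (fun s => eulerMaclaurinSum (cpowDeriv s) M x) s :=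
  .fun_sum fun r _ => (differentiableAt_cpowDeriv hs r hx).const_mul _

theorem differentiableAt_eulerMaclaurinError_cpowDeriv {s : ℂ} (hs : s ≠ 1) (M : ℕ) {x : ℂ}
    (hx : x ∈ slitPlane) :
    DifferentiableAt ℂ (fun s => eulerMaclaurinError (cpowDeriv s) M x) s :=
  have hx0 := slitPlane_ne_zero hx
  ((differentiableAt_eulerMaclaurinSum_cpowDeriv hs M
    (slitPlane_ne_zero (add_one_mem_slitPlane hx))).sub
      (differentiableAt_eulerMaclaurinSum_cpowDeriv hs M hx0)).sub
        (differentiableAt_cpowDeriv hs 1 hx0)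

theorem hasDerivAt_eulerMaclaurinSum_cpowDeriv (j M : ℕ) {x : ℂ} (hx : x ≠ 0) :
    HasDerivAt (fun s => eulerMaclaurinSum (cpowDeriv s) M x)
      (eulerMaclaurinSum (powLogDeriv j) M x) (-(j : ℂ)) :=
  .fun_sum fun r _ => (hasDerivAt_cpowDeriv_neg_natCast j r hx).const_mul _

theorem hasDerivAt_eulerMaclaurinError_cpowDeriv (j M : ℕ) {x : ℂ}
    (hx : x ∈ slitPlane) : HasDerivAt (fun s => eulerMaclaurinError (cpowDeriv s) M x)
      (eulerMaclaurinError (powLogDeriv j) M x) (-(j : ℂ)) :=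
  have hx0 := slitPlane_ne_zero hx
  ((hasDerivAt_eulerMaclaurinSum_cpowDeriv j M
    (slitPlane_ne_zero (add_one_mem_slitPlane hx))).sub
      (hasDerivAt_eulerMaclaurinSum_cpowDeriv j M hx0)).sub
        (hasDerivAt_cpowDeriv_neg_natCast j 1 hx0)

theorem norm_cpowDeriv_ofReal (s : ℂ) (r : ℕ) {x : ℝ} (hx : 0 < x) :
    ‖cpowDeriv s r x‖ = ‖cpowCoeff s r‖ * x ^ (1 - s.re - r) := by
  rw [cpowDeriv, norm_mul, norm_cpow_eq_rpow_re_of_pos hx]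
  simp

theorem norm_eulerMaclaurinError_cpowDeriv_le (M : ℕ) {s : ℂ} (hs : -(M : ℝ) - 1 ≤ s.re) {x : ℝ}
    (hx : 0 < x) : ‖eulerMaclaurinError (cpowDeriv s) M x‖ ≤
      eulerMaclaurinConst M * (‖cpowCoeff s (M + 2)‖ * x ^ (-(M : ℝ) - 1 - s.re)) := by
  refine norm_eulerMaclaurinError_le (fun r t ht => hasDerivAt_cpowDeriv s r
    (add_ofReal_mem_slitPlane (ofReal_mem_slitPlane.2 hx) ht.1)) M fun t ht => ?_
  have hexponent : 1 - s.re - (M + 2 : ℕ) = -(M : ℝ) - 1 - s.re := by push_cast; ring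
  rw [← ofReal_add, norm_cpowDeriv_ofReal s _ (by linarith [ht.1]), hexponent]
  exact mul_le_mul_of_nonneg_left
    (Real.rpow_le_rpow_of_nonpos hx (by linarith [ht.1]) (by linarith)) (norm_nonneg _)

theorem tendsto_eulerMaclaurinSum_cpowDeriv {s : ℂ} (hs : 1 < s.re) (M : ℕ) :
    Tendsto (fun N : ℕ => eulerMaclaurinSum (cpowDeriv s) M (N + 1)) atTop (𝓝 0) := by
  have hpow (r : ℕ) : Tendsto (fun N : ℕ => cpowDeriv s r (N + 1)) atTop (𝓝 0) := by
    have hrpow : Tendsto (fun N : ℕ => ((N : ℝ) + 1) ^ (-(s.re - 1 + r))) atTop (𝓝 0) :=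
      (tendsto_rpow_neg_atTop (by linarith [r.cast_nonneg (α := ℝ)])).comp
        (tendsto_atTop_add_const_right _ _ tendsto_natCast_atTop_atTop)
    have hexponent : 1 - s.re - r = -(s.re - 1 + r) := by ring
    rw [tendsto_zero_iff_norm_tendsto_zero, ← mul_zero ‖cpowCoeff s r‖]
    refine (hrpow.const_mul _).congr fun N => ?_
    rw [← hexponent, ← norm_cpowDeriv_ofReal s r N.cast_add_one_pos]
    push_cast
    rfl
  simpa [eulerMaclaurinSum] using
    tendsto_finsetSum (range (M + 1)) fun r _ => (hpow r).const_mul (bernoulli r / r ! : ℂ)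

theorem riemannZeta_eq_of_one_lt_re {s : ℂ} (hs : 1 < s.re) (M : ℕ)
    (hsum : Summable fun k : ℕ => eulerMaclaurinError (cpowDeriv s) M (k + 1)) :
    riemannZeta s = eulerMaclaurinSum (cpowDeriv s) M 1 +
      ∑' k : ℕ, eulerMaclaurinError (cpowDeriv s) M (k + 1) := by
  have hs1 : s ≠ 1 := ne_of_apply_ne re hs.ne'
  have hdirichlet : HasSum (fun k : ℕ => ((k : ℂ) + 1) ^ (-s)) (riemannZeta s) := by
    have hsummable := (summable_nat_add_iff 1).2 (summable_one_div_nat_cpow.2 hs)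
    rw [zeta_eq_tsum_one_div_nat_add_one_cpow hs]
    simpa [cpow_neg] using hsummable.hasSum
  have hpartial := hsum.hasSum.tendsto_sum_nat
  simp only [sum_eulerMaclaurinError, cpowDeriv_one hs1, sum_neg_distrib] at hpartial
  have hlimit := ((tendsto_eulerMaclaurinSum_cpowDeriv hs M).sub_const
    (eulerMaclaurinSum (cpowDeriv s) M 1)).sub hdirichlet.tendsto_sum_nat.neg
  rw [tendsto_nhds_unique hpartial hlimit]
  ring

/-- A bounded convex open set that contains `-j` and points with `1 < re s`, but not `1`; the
Euler–Maclaurin expansion of `ζ` is continued analytically along it. -/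
def zetaRegion (j : ℕ) : Set ℂ :=
  {s | -(j : ℝ) - 1 / 2 < s.re} ∩ {s | s.re - s.im < 1} ∩ Metric.ball 0 (j + 4)

theorem isOpen_zetaRegion (j : ℕ) : IsOpen (zetaRegion j) :=
  ((isOpen_lt continuous_const continuous_re).inter
    (isOpen_lt (continuous_re.sub continuous_im) continuous_const)).inter Metric.isOpen_ball

theorem isPreconnected_zetaRegion (j : ℕ) : IsPreconnected (zetaRegion j) :=
  (((convex_halfSpace_gt reLm.isLinear _).inter
    (convex_halfSpace_lt (reLm - imLm).isLinear _)).inter (convex_ball 0 _)).isPreconnected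

theorem ne_one_of_mem_zetaRegion {j : ℕ} {s : ℂ} (hs : s ∈ zetaRegion j) : s ≠ 1 := by
  rintro rfl
  simpa using hs.1.2

theorem neg_natCast_mem_zetaRegion (j : ℕ) : -(j : ℂ) ∈ zetaRegion j := by
  refine ⟨⟨?_, ?_⟩, ?_⟩
  · simp
  · simpa using neg_lt_iff_pos_add'.2 j.cast_add_one_pos
  · simp

theorem two_add_two_mul_I_mem_zetaRegion (j : ℕ) : 2 + 2 * I ∈ zetaRegion j := by
  have hj : (0 : ℝ) ≤ j := j.cast_nonneg
  refine ⟨⟨?_, ?_⟩, ?_⟩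
  · suffices -(j : ℝ) - 1 / 2 < 2 by simpa
    linarith
  · simp
  · rw [mem_ball_zero_iff, norm_eq_sqrt_sq_add_sq, Real.sqrt_lt' (by positivity)]
    suffices (2 : ℝ) ^ 2 + 2 ^ 2 < (j + 4) ^ 2 by simpa
    nlinarith only [hj]

theorem exists_bound_cpowCoeff (j r : ℕ) : ∃ C : ℝ, 0 ≤ C ∧ ∀ s ∈ zetaRegion j,
    ‖cpowCoeff s (r + 1)‖ ≤ C := by
  induction r with
  | zero =>
    exact ⟨1, zero_le_one, fun s hs => by simp [cpowCoeff_one (ne_one_of_mem_zetaRegion hs)]⟩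
  | succ r ih =>
    obtain ⟨C, hC, hle⟩ := ih
    refine ⟨C * (1 + (j + 4) + (r + 1)), by positivity, fun s hs => ?_⟩
    have hnorm : ‖s‖ ≤ j + 4 := (mem_ball_zero_iff.1 hs.2).le
    rw [cpowCoeff, norm_mul]
    refine mul_le_mul (hle s hs) ?_ (norm_nonneg _) hC
    calc ‖1 - s - (r + 1 : ℕ)‖ ≤ ‖(1 : ℂ)‖ + ‖s‖ + ‖((r + 1 : ℕ) : ℂ)‖ :=
          (norm_sub_le _ _).trans (add_le_add_left (norm_sub_le _ _) _)
      _ ≤ 1 + (j + 4) + (r + 1) := by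
          rw [norm_one, norm_natCast]
          push_cast
          gcongr

theorem exists_summable_bound_eulerMaclaurinError_cpowDeriv (j : ℕ) :
    ∃ u : ℕ → ℝ, Summable u ∧ ∀ k : ℕ, ∀ s ∈ zetaRegion j,
      ‖eulerMaclaurinError (cpowDeriv s) (j + 1) (k + 1)‖ ≤ u k := by
  obtain ⟨C, hC, hle⟩ := exists_bound_cpowCoeff j (j + 2)
  refine ⟨fun k => eulerMaclaurinConst (j + 1) * (C * ((k : ℝ) + 1) ^ (-(3 / 2) : ℝ)),
    (Summable.mul_left _ ?_).mul_left _, fun k s hs => ?_⟩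
  · simpa using (summable_nat_add_iff 1).2
      (Real.summable_nat_rpow.2 (show -(3 / 2 : ℝ) < -1 by norm_num))
  · have hre : -(j : ℝ) - 1 / 2 < s.re := hs.1.1
    have hbound := norm_eulerMaclaurinError_cpowDeriv_le (j + 1) (s := s)
      (by push_cast; linarith) k.cast_add_one_pos
    push_cast at hbound
    refine hbound.trans (mul_le_mul_of_nonneg_left ?_ (eulerMaclaurinConst_nonneg _))
    refine mul_le_mul (hle s hs) ?_ (by positivity) hC
    exact Real.rpow_le_rpow_of_exponent_le (by simp) (by linarith)

theorem differentiableOn_eulerMaclaurinError_cpowDeriv (j M k : ℕ) : DifferentiableOn ℂ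
    (fun s => eulerMaclaurinError (cpowDeriv s) M (k + 1)) (zetaRegion j) := fun _ hs =>
  (differentiableAt_eulerMaclaurinError_cpowDeriv (ne_one_of_mem_zetaRegion hs) M
    (natCast_add_one_mem_slitPlane k)).differentiableWithinAt

theorem differentiableOn_tsum_eulerMaclaurinError_cpowDeriv (j : ℕ) : DifferentiableOn ℂ
    (fun s => ∑' k : ℕ, eulerMaclaurinError (cpowDeriv s) (j + 1) (k + 1)) (zetaRegion j) := by
  obtain ⟨u, hu, hle⟩ := exists_summable_bound_eulerMaclaurinError_cpowDeriv j
  exact differentiableOn_tsum_of_summable_norm hu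
    (differentiableOn_eulerMaclaurinError_cpowDeriv j (j + 1)) (isOpen_zetaRegion j) hle

theorem riemannZeta_eqOn_zetaRegion (j : ℕ) : Set.EqOn riemannZeta
    (fun s => eulerMaclaurinSum (cpowDeriv s) (j + 1) 1 +
      ∑' k : ℕ, eulerMaclaurinError (cpowDeriv s) (j + 1) (k + 1)) (zetaRegion j) := by
  obtain ⟨u, hu, hle⟩ := exists_summable_bound_eulerMaclaurinError_cpowDeriv j
  have hopen := isOpen_zetaRegion j
  have hzeta : DifferentiableOn ℂ riemannZeta (zetaRegion j) := fun s hs =>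
    (differentiableAt_riemannZeta (ne_one_of_mem_zetaRegion hs)).differentiableWithinAt
  have hexpansion : DifferentiableOn ℂ
      (fun s => eulerMaclaurinSum (cpowDeriv s) (j + 1) 1) (zetaRegion j) := fun s hs =>
    (differentiableAt_eulerMaclaurinSum_cpowDeriv (ne_one_of_mem_zetaRegion hs) _
      one_ne_zero).differentiableWithinAt
  have hmem := two_add_two_mul_I_mem_zetaRegion j
  refine (hzeta.analyticOnNhd hopen).eqOn_of_preconnected_of_eventuallyEq
    ((hexpansion.add (differentiableOn_tsum_eulerMaclaurinError_cpowDeriv j)).analyticOnNhd hopen)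
    (isPreconnected_zetaRegion j) hmem ?_
  have hhalf : {s : ℂ | 1 < s.re} ∈ 𝓝 (2 + 2 * I) :=
    (isOpen_lt continuous_const continuous_re).mem_nhds (by norm_num)
  filter_upwards [hopen.mem_nhds hmem, hhalf] with s hs hs1
  exact riemannZeta_eq_of_one_lt_re hs1 _ (.of_norm_bounded hu fun k => hle k s hs)

theorem deriv_riemannZeta_neg_natCast (j : ℕ) : deriv riemannZeta (-(j : ℂ)) =
    eulerMaclaurinSum (powLogDeriv j) (j + 1) 1 +
      ∑' k : ℕ, eulerMaclaurinError (powLogDeriv j) (j + 1) (k + 1) := by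
  obtain ⟨u, hu, hle⟩ := exists_summable_bound_eulerMaclaurinError_cpowDeriv j
  have hmem := neg_natCast_mem_zetaRegion j
  have hnhds := (isOpen_zetaRegion j).mem_nhds hmem
  have hsum := hasSum_deriv_of_summable_norm hu
    (differentiableOn_eulerMaclaurinError_cpowDeriv j (j + 1)) (isOpen_zetaRegion j) hle hmem
  have hterm (k : ℕ) :
      deriv (fun s => eulerMaclaurinError (cpowDeriv s) (j + 1) (k + 1)) (-(j : ℂ)) =
        eulerMaclaurinError (powLogDeriv j) (j + 1) (k + 1) :=
    (hasDerivAt_eulerMaclaurinError_cpowDeriv j (j + 1)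
      (natCast_add_one_mem_slitPlane k)).deriv
  have htsum := ((differentiableOn_tsum_eulerMaclaurinError_cpowDeriv j).differentiableAt
    hnhds).hasDerivAt
  rw [← hsum.tsum_eq, tsum_congr hterm] at htsum
  rw [((riemannZeta_eqOn_zetaRegion j).eventuallyEq_of_mem hnhds).deriv_eq]
  exact ((hasDerivAt_eulerMaclaurinSum_cpowDeriv j (j + 1) one_ne_zero).add htsum).deriv

theorem funK_zero (j : ℕ) : funK j 0 = 0 := by
  have hterm (k : ℕ) : kTerm j 0 (k + 1) =
      eulerMaclaurinError (powLogDeriv j) (j + 1) (k + 1) := by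
    have hmem : 0 + ((k + 1 : ℕ) : ℂ) ∈ slitPlane := by simpa using natCast_add_one_mem_slitPlane k
    rw [kTerm_eq_eulerMaclaurinError j hmem, zero_add, Nat.cast_succ]
  rw [funK_eq, deriv_riemannZeta_neg_natCast, tsum_congr hterm, zero_add]
  ring

/-! ### Growth on the right half-plane -/

/-- `f` grows at most like `‖z‖ ^ p` on the closed right half-plane; the gauge `(1 + ‖z‖) ^ p`
spares a discussion of `z = 0`. -/
def HasGrowthOfOrder (f : ℂ → ℂ) (p : ℝ) : Prop :=
  f =O[𝓟 {z : ℂ | 0 ≤ z.re}] fun z => (1 + ‖z‖) ^ p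

namespace HasGrowthOfOrder

variable {f g : ℂ → ℂ} {p q : ℝ}

theorem of_le (C : ℝ) (h : ∀ z : ℂ, 0 ≤ z.re → ‖f z‖ ≤ C * (1 + ‖z‖) ^ p) :
    HasGrowthOfOrder f p :=
  .of_bound C <| eventually_principal.2 fun z hz =>
    (h z hz).trans_eq (by rw [Real.norm_of_nonneg (by positivity)])

theorem exists_bound (hf : HasGrowthOfOrder f p) :
    ∃ C : ℝ, 0 ≤ C ∧ ∀ z : ℂ, 0 ≤ z.re → ‖f z‖ ≤ C * (1 + ‖z‖) ^ p := by
  obtain ⟨C, hC, hle⟩ := Asymptotics.IsBigO.exists_nonneg hf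
  refine ⟨C, hC, fun z hz => (eventually_principal.1 hle.bound z hz).trans_eq ?_⟩
  rw [Real.norm_of_nonneg (by positivity)]

theorem add (hf : HasGrowthOfOrder f p) (hg : HasGrowthOfOrder g p) :
    HasGrowthOfOrder (fun z => f z + g z) p :=
  Asymptotics.IsBigO.add hf hg

theorem sub (hf : HasGrowthOfOrder f p) (hg : HasGrowthOfOrder g p) :
    HasGrowthOfOrder (fun z => f z - g z) p :=
  Asymptotics.IsBigO.sub hf hg

theorem sum {ι : Type*} {s : Finset ι} {f : ι → ℂ → ℂ} (hf : ∀ i ∈ s, HasGrowthOfOrder (f i) p) :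
    HasGrowthOfOrder (fun z => ∑ i ∈ s, f i z) p :=
  Asymptotics.IsBigO.fun_sum hf

theorem mono (hf : HasGrowthOfOrder f p) (hpq : p ≤ q) : HasGrowthOfOrder f q := by
  obtain ⟨C, hC, hle⟩ := hf.exists_bound
  refine of_le C fun z hz => (hle z hz).trans ?_
  gcongr
  exact le_add_of_nonneg_right (norm_nonneg z)

theorem mul (hf : HasGrowthOfOrder f p) (hg : HasGrowthOfOrder g q) :
    HasGrowthOfOrder (fun z => f z * g z) (p + q) :=
  (Asymptotics.IsBigO.mul hf hg).congr_right fun z => (Real.rpow_add (by positivity) p q).symm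

theorem const (c : ℂ) (hp : 0 ≤ p) : HasGrowthOfOrder (fun _ => c) p := by
  refine (of_le ‖c‖ fun z _ => ?_ : HasGrowthOfOrder _ 0).mono hp
  rw [Real.rpow_zero, mul_one]

theorem const_mul (hf : HasGrowthOfOrder f p) (c : ℂ) :
    HasGrowthOfOrder (fun z => c * f z) p :=
  Asymptotics.IsBigO.const_mul_left hf c

theorem add_const (c : ℂ) : HasGrowthOfOrder (fun z => z + c) 1 := by
  refine of_le (1 + ‖c‖) fun z _ => (norm_add_le z c).trans ?_
  rw [Real.rpow_one]
  nlinarith [norm_nonneg z, norm_nonneg c]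

theorem pow (hf : HasGrowthOfOrder f p) (n : ℕ) :
    HasGrowthOfOrder (fun z => f z ^ n) (n * p) :=
  (Asymptotics.IsBigO.pow hf n).congr_right fun z => by
    rw [mul_comm, Real.rpow_mul_natCast (by positivity)]

end HasGrowthOfOrder

theorem hasGrowthOfOrder_log_add_one : HasGrowthOfOrder (fun z => log (z + 1)) (1 / 2) := by
  refine .of_le (2 + Real.pi) fun z hz => ?_
  have hone : 1 ≤ ‖z + 1‖ := (by simpa using hz : (1 : ℝ) ≤ (z + 1).re).trans (re_le_norm _)
  have hnorm : ‖z + 1‖ ≤ 1 + ‖z‖ := by simpa [add_comm] using norm_add_le z 1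
  have hlog : Real.log ‖z + 1‖ ≤ 2 * (1 + ‖z‖) ^ (1 / 2 : ℝ) := by
    refine (Real.log_le_log (one_pos.trans_le hone) hnorm).trans ?_
    refine (Real.log_le_rpow_div (by positivity) (one_half_pos (α := ℝ))).trans_eq ?_
    ring
  have hgauge : 1 ≤ (1 + ‖z‖) ^ (1 / 2 : ℝ) :=
    Real.one_le_rpow (le_add_of_nonneg_right (norm_nonneg z)) (by positivity)
  calc ‖log (z + 1)‖ ≤ |(log (z + 1)).re| + |(log (z + 1)).im| := norm_le_abs_re_add_abs_im _
    _ ≤ 2 * (1 + ‖z‖) ^ (1 / 2 : ℝ) + Real.pi := by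
      rw [log_re, log_im, abs_of_nonneg (Real.log_nonneg hone)]
      exact add_le_add hlog (abs_arg_le_pi _)
    _ ≤ (2 + Real.pi) * (1 + ‖z‖) ^ (1 / 2 : ℝ) := by nlinarith [Real.pi_pos]

theorem hasGrowthOfOrder_powLogDeriv {j r : ℕ} (hr : r ≤ j + 1) :
    HasGrowthOfOrder (fun z => powLogDeriv j r (z + 1)) (j + 3 / 2) := by
  have hpow : HasGrowthOfOrder (fun z => (z + 1) ^ (j + 1 - r)) (j + 1) := by
    refine ((HasGrowthOfOrder.add_const 1).pow (j + 1 - r)).mono ?_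
    rw [mul_one]
    exact_mod_cast Nat.sub_le (j + 1) r
  have hlog : HasGrowthOfOrder (fun z => powLogCoeff j r * log (z + 1) + powLogConst j r) (1 / 2) :=
    (hasGrowthOfOrder_log_add_one.const_mul _).add (.const _ (by positivity))
  simp only [powLogDeriv_eq_pow hr]
  exact (hpow.mul hlog).mono (by linarith)

theorem hasGrowthOfOrder_funK (j : ℕ) : HasGrowthOfOrder (funK j) (j + 3 / 2) := by
  obtain ⟨u, hu, hle⟩ := exists_summable_bound_kTerm j
  have hj : (0 : ℝ) ≤ j + 3 / 2 := by positivity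
  have hsum : HasGrowthOfOrder
      (fun z => eulerMaclaurinSum (powLogDeriv j) (j + 1) (z + 1)) (j + 3 / 2) :=
    .sum fun r hr => (hasGrowthOfOrder_powLogDeriv (mem_range_succ_iff.1 hr)).const_mul _
  have htsum : HasGrowthOfOrder (fun z => ∑' k : ℕ, kTerm j z (k + 1)) 0 := by
    refine .of_le (∑' k, u k) fun z hz => ?_
    simpa using tsum_of_norm_bounded hu.hasSum (hle z hz)
  rw [funext (funK_eq j)]
  exact (hsum.sub (.const _ hj)).add (htsum.mono hj)

/-! ### The coefficients of `(z - u).choose m` -/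

section ShiftedChoose

open Polynomial

/-- The polynomial `(z - u).choose m` in the variable `u`. -/
noncomputable def shiftedChoose (m : ℕ) (z : ℂ) : ℂ[X] :=
  C (m ! : ℂ)⁻¹ * (descPochhammer ℂ m).comp (C z - X)

theorem binomCoeffPoly_eq_coeff (m j : ℕ) (z : ℂ) :
    binomCoeffPoly (m + 1) j z = (shiftedChoose m z).coeff j := rfl

theorem natDegree_shiftedChoose_le (m : ℕ) (z : ℂ) : (shiftedChoose m z).natDegree ≤ m := by
  refine (natDegree_C_mul_le _ _).trans (natDegree_comp_le.trans ?_)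
  have hdeg : (C z - X : ℂ[X]).natDegree ≤ 1 := by compute_degree
  rw [descPochhammer_natDegree]
  exact (Nat.mul_le_mul_left m hdeg).trans_eq m.mul_one

theorem eval_shiftedChoose_self (m : ℕ) (z : ℂ) :
    (shiftedChoose m z).eval z = if m = 0 then 1 else 0 := by
  rw [shiftedChoose, eval_mul, eval_comp, eval_sub, eval_C, eval_C, eval_X, sub_self,
    descPochhammer_eval_zero]
  split_ifs with hm <;> simp [hm]

theorem shiftedChoose_succ (m : ℕ) (z : ℂ) :
    shiftedChoose (m + 1) z = C ((m : ℂ) + 1)⁻¹ * (C (z - m) * shiftedChoose m z -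
      X * shiftedChoose m z) := by
  rw [shiftedChoose, shiftedChoose, descPochhammer_succ_right, Nat.factorial_succ, Nat.cast_mul,
    mul_inv, C_mul, mul_comp, sub_comp, X_comp, natCast_comp, Nat.cast_succ, C_sub, ← C_eq_natCast]
  ring

theorem shiftedChoose_succ_add_one (m : ℕ) (z : ℂ) :
    shiftedChoose (m + 1) (z + 1) = shiftedChoose (m + 1) z + shiftedChoose m z := by
  have hX : (C (z + 1) - X : ℂ[X]) - 1 = C z - X := by rw [C_add, C_1]; ring
  have hm : ((m + 1)! : ℂ)⁻¹ * (m + 1) = (m ! : ℂ)⁻¹ := by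
    rw [Nat.factorial_succ, Nat.cast_mul, Nat.cast_succ, mul_inv,
      mul_right_comm, inv_mul_cancel₀ m.cast_add_one_ne_zero, one_mul]
  have hpascal := congrArg (comp · (C (z + 1) - X)) (descPochhammer_succ_comp_X_sub_one (R := ℂ) m)
  simp only [smul_eq_mul, mul_comp, comp_assoc, sub_comp, add_comp, natCast_comp, X_comp, one_comp,
    hX] at hpascal
  rw [shiftedChoose, shiftedChoose, shiftedChoose, hpascal, ← hm, C_mul, C_add (a := (m : ℂ)), C_1,
    map_natCast]
  ring

end ShiftedChoose

theorem binomCoeffPoly_add_one (m j : ℕ) (z : ℂ) : binomCoeffPoly (m + 2) j (z + 1) =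
    binomCoeffPoly (m + 2) j z + binomCoeffPoly (m + 1) j z := by
  simp only [binomCoeffPoly_eq_coeff, shiftedChoose_succ_add_one, Polynomial.coeff_add]

theorem binomCoeffPoly_self (m : ℕ) (z : ℂ) : binomCoeffPoly (m + 1) (m + 1) z = 0 :=
  Polynomial.coeff_eq_zero_of_natDegree_lt (Nat.lt_succ_of_le (natDegree_shiftedChoose_le m z))

theorem sum_binomCoeffPoly_mul_pow_self (m : ℕ) (z : ℂ) :
    ∑ j ∈ range (m + 1), binomCoeffPoly (m + 1) j z * z ^ j = if m = 0 then 1 else 0 := by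
  simp only [binomCoeffPoly_eq_coeff]
  rw [← eval_shiftedChoose_self m z,
    Polynomial.eval_eq_sum_range' (Nat.lt_succ_of_le (natDegree_shiftedChoose_le m z))]

theorem binomCoeffPoly_one (j : ℕ) (z : ℂ) :
    binomCoeffPoly 1 j z = if j = 0 then 1 else 0 := by
  simp [binomCoeffPoly, Polynomial.coeff_one]

theorem binomCoeffPoly_succ_zero (m : ℕ) (z : ℂ) :
    binomCoeffPoly (m + 2) 0 z = ((m : ℂ) + 1)⁻¹ * ((z - m) * binomCoeffPoly (m + 1) 0 z) := by
  simp only [binomCoeffPoly_eq_coeff, shiftedChoose_succ, Polynomial.coeff_C_mul,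
    Polynomial.coeff_sub, Polynomial.coeff_X_mul_zero, sub_zero]

theorem binomCoeffPoly_succ_succ (m j : ℕ) (z : ℂ) :
    binomCoeffPoly (m + 2) (j + 1) z = ((m : ℂ) + 1)⁻¹ *
      ((z - m) * binomCoeffPoly (m + 1) (j + 1) z - binomCoeffPoly (m + 1) j z) := by
  simp only [binomCoeffPoly_eq_coeff, shiftedChoose_succ, Polynomial.coeff_C_mul,
    Polynomial.coeff_sub, Polynomial.coeff_X_mul]

theorem differentiable_binomCoeffPoly (m j : ℕ) :
    Differentiable ℂ (binomCoeffPoly (m + 1) j) := by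
  induction m generalizing j with
  | zero => simpa only [funext (binomCoeffPoly_one j)] using differentiable_const _
  | succ m ih =>
    have hlin : Differentiable ℂ fun z : ℂ => z - m := by fun_prop
    cases j with
    | zero =>
      rw [funext (binomCoeffPoly_succ_zero m)]
      exact (hlin.mul (ih 0)).const_mul _
    | succ j =>
      rw [funext (binomCoeffPoly_succ_succ m j)]
      exact ((hlin.mul (ih (j + 1))).sub (ih j)).const_mul _

theorem hasGrowthOfOrder_binomCoeffPoly (m j : ℕ) :
    HasGrowthOfOrder (binomCoeffPoly (m + 1) j) ((m : ℝ) - j) := by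
  induction m generalizing j with
  | zero =>
    rw [funext (binomCoeffPoly_one j)]
    cases j with
    | zero => exact .const _ (by simp)
    | succ j => exact .of_le 0 fun z _ => by simp
  | succ m ih =>
    have hlin (i : ℕ) :
        HasGrowthOfOrder (fun z => (z - m) * binomCoeffPoly (m + 1) i z) ((m + 1 : ℕ) - i) :=
      ((HasGrowthOfOrder.add_const (-m)).mul (ih i)).mono (by push_cast; linarith)
    cases j with
    | zero =>
      rw [funext (binomCoeffPoly_succ_zero m)]
      exact (hlin 0).const_mul _
    | succ j =>
      rw [funext (binomCoeffPoly_succ_succ m j)]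
      exact ((hlin (j + 1)).sub ((ih j).mono (by push_cast; linarith))).const_mul _

/-! ### The logarithms of the multiple gamma functions -/

theorem closedBall_half_subset_re_pos {x : ℝ} (hx : 0 < x) :
    Metric.closedBall (x : ℂ) (x / 2) ⊆ {z : ℂ | 0 < z.re} := by
  intro z hz
  have hre : -(x / 2) ≤ z.re - x :=
    (abs_le.1 ((abs_re_le_norm (z - x)).trans (mem_closedBall_iff_norm.1 hz))).1
  exact (half_pos hx).trans_le (by linarith)

theorem HasGrowthOfOrder.exists_norm_iteratedDeriv_le {f : ℂ → ℂ} {p : ℝ}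
    (hf : HasGrowthOfOrder f p) (hdiff : DifferentiableOn ℂ f {z : ℂ | 0 < z.re}) (hp : 0 ≤ p)
    (m : ℕ) : ∃ C : ℝ, ∀ x : ℝ, 1 ≤ x → ‖iteratedDeriv m f x‖ ≤ C * x ^ (p - m) := by
  obtain ⟨C, hC, hle⟩ := hf.exists_bound
  refine ⟨m ! * C * 3 ^ p * 2 ^ m, fun x hx => ?_⟩
  have hx0 : 0 < x := one_pos.trans_le hx
  have hsub := closedBall_half_subset_re_pos hx0
  have hcont : DiffContOnCl ℂ f (Metric.ball (x : ℂ) (x / 2)) :=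
    (hdiff.mono (Metric.closure_ball_subset_closedBall.trans hsub)).diffContOnCl
  have hsphere : ∀ z ∈ Metric.sphere (x : ℂ) (x / 2), ‖f z‖ ≤ C * (3 * x) ^ p := by
    intro z hz
    have hre : 0 < z.re := hsub (Metric.sphere_subset_closedBall hz)
    have hnorm : ‖z‖ ≤ x / 2 + x := by
      simpa [mem_sphere_iff_norm.1 hz, abs_of_pos hx0, add_comm] using
        norm_le_norm_add_norm_sub' z x
    refine (hle z hre.le).trans ?_
    gcongr
    linarith
  calc ‖iteratedDeriv m f x‖ ≤ m ! * (C * (3 * x) ^ p) / (x / 2) ^ m :=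
        norm_iteratedDeriv_le_of_forall_mem_sphere_norm_le m (half_pos hx0) hcont hsphere
    _ = m ! * C * 3 ^ p * 2 ^ m * x ^ (p - m) := by
        rw [Real.mul_rpow zero_le_three hx0.le, Real.rpow_sub hx0, Real.rpow_natCast,
          div_pow]
        field_simp

theorem HasGrowthOfOrder.tendsto_iteratedDeriv {f : ℂ → ℂ} {p : ℝ} (hf : HasGrowthOfOrder f p)
    (hdiff : DifferentiableOn ℂ f {z : ℂ | 0 < z.re}) (hp : 0 ≤ p) {m : ℕ} (hpm : p < m) :
    Tendsto (fun x : ℝ => iteratedDeriv m f x) atTop (𝓝 0) := by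
  obtain ⟨C, hle⟩ := hf.exists_norm_iteratedDeriv_le hdiff hp m
  have hlim : Tendsto (fun x : ℝ => C * x ^ (p - m)) atTop (𝓝 0) := by
    simpa using (tendsto_rpow_neg_atTop (sub_pos.2 hpm)).const_mul C
  exact squeeze_zero_norm' ((eventually_ge_atTop 1).mono hle) hlim

/-- The logarithm of the `n`-th multiple gamma function at `z + 1`. -/
noncomputable def logMultipleGamma : ℕ → ℂ → ℂ
  | 0, z => log (z + 1)
  | n + 1, z => ∑ j ∈ range (n + 1), binomCoeffPoly (n + 1) j z * funK j z

theorem logMultipleGamma_zero_right (n : ℕ) : logMultipleGamma n 0 = 0 := by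
  cases n <;> simp [logMultipleGamma, funK_zero]

theorem logMultipleGamma_one (z : ℂ) : logMultipleGamma 1 z = funK 0 z := by
  simp [logMultipleGamma, binomCoeffPoly_one]

theorem sum_binomCoeffPoly_add_one_mul_funK (m : ℕ) (z : ℂ) :
    ∑ j ∈ range (m + 2), binomCoeffPoly (m + 2) j (z + 1) * funK j z =
      logMultipleGamma (m + 2) z + logMultipleGamma (m + 1) z := by
  simp only [binomCoeffPoly_add_one, add_mul]
  rw [sum_add_distrib, sum_range_succ (fun j => binomCoeffPoly (m + 1) j z * funK j z),
    binomCoeffPoly_self, zero_mul, add_zero]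
  rfl

theorem logMultipleGamma_add_one (n : ℕ) {z : ℂ} (hz : z + 1 ∈ slitPlane) :
    logMultipleGamma (n + 1) (z + 1) = logMultipleGamma (n + 1) z + logMultipleGamma n z := by
  have hsplit : logMultipleGamma (n + 1) (z + 1) =
      ∑ j ∈ range (n + 1), binomCoeffPoly (n + 1) j (z + 1) * funK j z +
        (if n = 0 then 1 else 0) * log (z + 1) := by
    rw [← sum_binomCoeffPoly_mul_pow_self n (z + 1), sum_mul, ← sum_add_distrib]
    exact sum_congr rfl fun j _ => by rw [funK_add_one j hz]; ring
  cases n with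
  | zero =>
    rw [hsplit, logMultipleGamma_one]
    simp [binomCoeffPoly_one, logMultipleGamma]
  | succ m =>
    rw [hsplit, if_neg m.succ_ne_zero, zero_mul, add_zero, sum_binomCoeffPoly_add_one_mul_funK]

theorem differentiableOn_logMultipleGamma (n : ℕ) :
    DifferentiableOn ℂ (logMultipleGamma n) {z : ℂ | z + 1 ∈ slitPlane} := by
  cases n with
  | zero =>
    intro z hz
    have hlog : DifferentiableAt ℂ (fun w : ℂ => log (w + 1)) z := .clog (by fun_prop) hz
    exact hlog.differentiableWithinAt
  | succ n =>
    exact .fun_sum fun j _ =>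
      (differentiable_binomCoeffPoly n j).differentiableOn.mul (differentiableOn_funK j)

theorem analyticAt_logMultipleGamma (n : ℕ) {z : ℂ} (hz : z + 1 ∈ slitPlane) :
    AnalyticAt ℂ (logMultipleGamma n) z :=
  (differentiableOn_logMultipleGamma n).analyticAt (isOpen_add_one_mem_slitPlane.mem_nhds hz)

theorem hasGrowthOfOrder_logMultipleGamma (n : ℕ) :
    HasGrowthOfOrder (logMultipleGamma n) (n + 1 / 2) := by
  cases n with
  | zero => exact hasGrowthOfOrder_log_add_one.mono (by simp)
  | succ n =>
    exact .sum fun j _ => ((hasGrowthOfOrder_binomCoeffPoly n j).mul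
      (hasGrowthOfOrder_funK j)).mono (by push_cast; linarith)

theorem tendsto_iteratedDeriv_logMultipleGamma {n m : ℕ} (hm : n < m) :
    Tendsto (fun x : ℝ => iteratedDeriv m (logMultipleGamma n) x) atTop (𝓝 0) := by
  have hdiff : DifferentiableOn ℂ (logMultipleGamma n) {z : ℂ | 0 < z.re} :=
    (differentiableOn_logMultipleGamma n).mono fun z hz =>
      add_one_mem_slitPlane (mem_slitPlane_of_re_pos hz)
  have hm : (n : ℝ) + 1 ≤ m := mod_cast hm
  exact (hasGrowthOfOrder_logMultipleGamma n).tendsto_iteratedDeriv hdiff (by positivity)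
    (by linarith)

/-! ### Periodic functions on a half-line -/

theorem nonneg_of_add_one_le_of_eventually_le {g v : ℝ → ℝ} {a : ℝ}
    (hstep : ∀ x, a < x → g (x + 1) ≤ g x) (hv : Tendsto v atTop (𝓝 0))
    (hle : ∀ᶠ x in atTop, v x ≤ g x) {x : ℝ} (hx : a < x) : 0 ≤ g x := by
  have hshift (N : ℕ) : g (x + N) ≤ g x := by
    induction N with
    | zero => simp
    | succ N ih =>
      rw [Nat.cast_succ, ← add_assoc]
      exact (hstep _ (lt_add_of_lt_of_nonneg hx N.cast_nonneg)).trans ih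
  have htop : Tendsto (fun N : ℕ => x + N) atTop atTop :=
    tendsto_atTop_add_const_left _ _ tendsto_natCast_atTop_atTop
  exact le_of_tendsto (hv.comp htop) ((htop.eventually hle).mono fun N hN => hN.trans (hshift N))

section Periodic

variable {f : ℝ → ℝ} {a : ℝ}

theorem iteratedDeriv_add_one_eq (hper : ∀ x, a < x → f (x + 1) = f x) (n : ℕ) {x : ℝ}
    (hx : a < x) : iteratedDeriv n f (x + 1) = iteratedDeriv n f x := by
  have hloc : (fun y => f (y + 1)) =ᶠ[𝓝 x] f := eventually_of_mem (Ioi_mem_nhds hx) hper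
  rw [← hloc.iteratedDeriv_eq, iteratedDeriv_comp_add_const]

theorem eq_of_periodic_of_deriv_nonneg (hf : DifferentiableOn ℝ f (Set.Ioi a))
    (hper : ∀ x, a < x → f (x + 1) = f x) (hderiv : ∀ x, a < x → 0 ≤ deriv f x) {x y : ℝ}
    (hx : a < x) (hy : a < y) : f x = f y := by
  wlog hxy : x ≤ y generalizing x y
  · exact (this hy hx (le_of_not_ge hxy)).symm
  have hmono : MonotoneOn f (Set.Ioi a) := by
    refine monotoneOn_of_deriv_nonneg (convex_Ioi a) hf.continuousOn ?_ ?_ <;> rw [interior_Ioi]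
    · exact hf
    · exact hderiv
  have hshift (N : ℕ) : f (x + N) = f x := by
    induction N with
    | zero => simp
    | succ N ih =>
      rw [Nat.cast_succ, ← add_assoc, hper _ (lt_add_of_lt_of_nonneg hx N.cast_nonneg), ih]
  obtain ⟨N, hN⟩ := exists_nat_ge (y - x)
  have hyN : y ≤ x + N := sub_le_iff_le_add'.1 hN
  exact (hmono hx hy hxy).antisymm (hshift N ▸ hmono hy (hy.trans_le hyN) hyN)

theorem eq_of_periodic_of_iteratedDeriv_nonneg {n : ℕ} (hf : ContDiffOn ℝ (n + 1) f (Set.Ioi a))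
    (hper : ∀ x, a < x → f (x + 1) = f x) (hderiv : ∀ x, a < x → 0 ≤ iteratedDeriv (n + 1) f x)
    {x y : ℝ} (hx : a < x) (hy : a < y) : f x = f y := by
  induction n generalizing f x y with
  | zero =>
    exact eq_of_periodic_of_deriv_nonneg (hf.differentiableOn (by simp)) hper
      (by simpa using hderiv) hx hy
  | succ n ih =>
    have hdiff : DifferentiableOn ℝ f (Set.Ioi a) := hf.differentiableOn (by simp)
    have hderivper : ∀ x, a < x → deriv f (x + 1) = deriv f x := fun x hx => by
      simpa only [iteratedDeriv_one] using iteratedDeriv_add_one_eq hper 1 hx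
    have hcontDiff : ContDiffOn ℝ (n + 1) (deriv f) (Set.Ioi a) := by
      rw [Nat.cast_succ, contDiffOn_succ_iff_deriv_of_isOpen isOpen_Ioi] at hf
      exact hf.2.2
    have hconst {x y : ℝ} (hx : a < x) (hy : a < y) : deriv f x = deriv f y :=
      ih hcontDiff hderivper (fun x hx => by simpa only [iteratedDeriv_succ'] using hderiv x hx)
        hx hy
    refine eq_of_periodic_of_deriv_nonneg hdiff hper (fun x hx => ?_) hx hy
    -- By Rolle's theorem, the constant value of `deriv f` is `0`.
    obtain ⟨c, hc, hc0⟩ := exists_deriv_eq_zero (lt_add_one x)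
      (hdiff.continuousOn.mono fun t ht => hx.trans_le ht.1) (hper x hx).symm
    exact (hc0.symm.trans (hconst (hx.trans hc.1) hx)).le

theorem eq_of_periodic_of_le_iteratedDeriv {n : ℕ} (hf : ContDiffOn ℝ (n + 1) f (Set.Ioi a))
    (hper : ∀ x, a < x → f (x + 1) = f x) {v : ℝ → ℝ} (hv : Tendsto v atTop (𝓝 0))
    (hle : ∀ᶠ x in atTop, v x ≤ iteratedDeriv (n + 1) f x) {x y : ℝ} (hx : a < x) (hy : a < y) :
    f x = f y :=
  eq_of_periodic_of_iteratedDeriv_nonneg hf hper (fun _ hx =>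
    nonneg_of_add_one_le_of_eventually_le
      (fun _ hx => (iteratedDeriv_add_one_eq hper (n + 1) hx).le) hv hle hx) hx hy

end Periodic

/-! ### Derivatives along the real axis -/

theorem hasDerivAt_iteratedDeriv_of_analyticAt {f : ℂ → ℂ} {z : ℂ} (hf : AnalyticAt ℂ f z)
    (m : ℕ) : HasDerivAt (iteratedDeriv m f) (iteratedDeriv (m + 1) f z) z := by
  rw [iteratedDeriv_succ, iteratedDeriv_eq_iterate]
  exact (hf.iterated_deriv m).differentiableAt.hasDerivAt

theorem contDiffAt_clm_comp_ofReal (l : ℂ →L[ℝ] ℝ) {f : ℂ → ℂ} {x : ℝ} (hf : AnalyticAt ℂ f x)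
    {n : WithTop ℕ∞} : ContDiffAt ℝ n (fun t : ℝ => l (f t)) x :=
  l.contDiff.contDiffAt.comp x
    ((hf.contDiffAt.restrict_scalars ℝ).comp x ofRealCLM.contDiff.contDiffAt)

theorem iteratedDeriv_clm_comp_ofReal (l : ℂ →L[ℝ] ℝ) {f : ℂ → ℂ} (m : ℕ) {x : ℝ}
    (hf : AnalyticAt ℂ f x) :
    iteratedDeriv m (fun t : ℝ => l (f t)) x = l (iteratedDeriv m f x) := by
  induction m generalizing x with
  | zero => simp only [iteratedDeriv_zero]
  | succ m ih =>
    have hloc : iteratedDeriv m (fun t : ℝ => l (f t)) =ᶠ[𝓝 x]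
        fun t : ℝ => l (iteratedDeriv m f t) :=
      (continuous_ofReal.continuousAt.eventually hf.eventually_analyticAt).mono fun _ ht => ih ht
    rw [iteratedDeriv_succ, hloc.deriv_eq]
    exact (l.hasFDerivAt.comp_hasDerivAt x
      (hasDerivAt_iteratedDeriv_of_analyticAt hf m).comp_ofReal).deriv

theorem ofReal_add_one_mem_slitPlane {x : ℝ} (hx : -1 < x) : (x : ℂ) + 1 ∈ slitPlane := by
  rw [← ofReal_one, ← ofReal_add, ofReal_mem_slitPlane]
  exact neg_lt_iff_pos_add.1 hx

theorem contDiffOn_clm_logMultipleGamma (l : ℂ →L[ℝ] ℝ) (n : ℕ) {m : WithTop ℕ∞} :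
    ContDiffOn ℝ m (fun t : ℝ => l (logMultipleGamma n t)) (Set.Ioi (-1)) := fun _ hx =>
  (contDiffAt_clm_comp_ofReal l (analyticAt_logMultipleGamma n
    (ofReal_add_one_mem_slitPlane hx))).contDiffWithinAt

theorem tendsto_iteratedDeriv_clm_logMultipleGamma (l : ℂ →L[ℝ] ℝ) {n m : ℕ} (hm : n < m) :
    Tendsto (iteratedDeriv m fun t : ℝ => l (logMultipleGamma n t)) atTop (𝓝 0) := by
  have hlim := (l.continuous.tendsto 0).comp (tendsto_iteratedDeriv_logMultipleGamma hm)
  rw [map_zero] at hlim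
  refine hlim.congr' ?_
  filter_upwards [eventually_gt_atTop (-1)] with x hx using (iteratedDeriv_clm_comp_ofReal l m
    (analyticAt_logMultipleGamma n (ofReal_add_one_mem_slitPlane hx))).symm

theorem iteratedDeriv_clm_logMultipleGamma_add_one (l : ℂ →L[ℝ] ℝ) (n m : ℕ) {x : ℝ}
    (hx : -1 < x) :
    iteratedDeriv m (fun t : ℝ => l (logMultipleGamma (n + 1) t)) (x + 1) =
      iteratedDeriv m (fun t : ℝ => l (logMultipleGamma (n + 1) t)) x +
        iteratedDeriv m (fun t : ℝ => l (logMultipleGamma n t)) x := by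
  have hcontDiff (k : ℕ) : ContDiffAt ℝ m (fun t : ℝ => l (logMultipleGamma k t)) x :=
    contDiffAt_clm_comp_ofReal l (analyticAt_logMultipleGamma k (ofReal_add_one_mem_slitPlane hx))
  have hloc : (fun t : ℝ => l (logMultipleGamma (n + 1) (t + 1 : ℝ))) =ᶠ[𝓝 x]
      fun t : ℝ => l (logMultipleGamma (n + 1) t) + l (logMultipleGamma n t) := by
    filter_upwards [Ioi_mem_nhds hx] with t ht
    rw [ofReal_add, ofReal_one, logMultipleGamma_add_one n (ofReal_add_one_mem_slitPlane ht),
      map_add]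
  rw [← iteratedDeriv_fun_add (hcontDiff (n + 1)) (hcontDiff n), ← hloc.iteratedDeriv_eq,
    iteratedDeriv_comp_add_const (f := fun t : ℝ => l (logMultipleGamma (n + 1) t))]

theorem iteratedDeriv_re_logMultipleGamma_zero (m : ℕ) {x : ℝ} (hx : -1 < x) :
    iteratedDeriv (m + 1) (fun t : ℝ => (logMultipleGamma 0 t).re) x =
      (-1) ^ m * (m ! * (x + 1) ^ (-(m : ℤ) - 1)) := by
  have hmem := ofReal_add_one_mem_slitPlane hx
  have hlog : iteratedDeriv (m + 1) (logMultipleGamma 0) x =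
      ((-1) ^ m * (m ! * (x + 1) ^ (-(m : ℤ) - 1)) : ℝ) := by
    refine (congrFun (iteratedDeriv_comp_add_const (m + 1) log 1) _).trans
      ((iteratedDeriv_succ_log hmem).trans ?_)
    push_cast
    ring
  exact (iteratedDeriv_clm_comp_ofReal reCLM (m + 1) (analyticAt_logMultipleGamma 0 hmem)).trans
    (congrArg re hlog)

theorem neg_one_pow_mul_iteratedDeriv_logMultipleGamma_nonneg (n : ℕ) {m : ℕ} (hm : n < m) {x : ℝ}
    (hx : -1 < x) :
    0 ≤ (-1) ^ (m + n + 1) * iteratedDeriv m (fun t : ℝ => (logMultipleGamma n t).re) x := by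
  induction n generalizing x with
  | zero =>
    obtain ⟨m, rfl⟩ := Nat.exists_eq_add_one_of_ne_zero hm.ne'
    have hx0 : 0 < x + 1 := neg_lt_iff_pos_add.1 hx
    have heven : Even (m + 1 + 0 + 1 + m) := ⟨m + 1, by ring⟩
    rw [iteratedDeriv_re_logMultipleGamma_zero m hx, ← mul_assoc, ← pow_add, heven.neg_one_pow,
      one_mul]
    positivity
  | succ n ih =>
    have hlim := (tendsto_iteratedDeriv_clm_logMultipleGamma reCLM hm).const_mul
      ((-1) ^ (m + (n + 1) + 1))
    rw [mul_zero] at hlim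
    refine nonneg_of_add_one_le_of_eventually_le (fun y hy => ?_) hlim (.of_forall fun _ => le_rfl)
      hx
    have hn := ih (Nat.lt_of_succ_lt hm) hy
    have hadd := iteratedDeriv_clm_logMultipleGamma_add_one reCLM n m hy
    simp only [reCLM_apply] at hadd ⊢
    rw [hadd, ← add_assoc m n 1, pow_succ]
    linarith

theorem logMultipleGamma_im (n : ℕ) {x : ℝ} (hx : -1 < x) : (logMultipleGamma n x).im = 0 := by
  induction n generalizing x with
  | zero =>
    rw [logMultipleGamma, ← ofReal_one, ← ofReal_add, ← ofReal_log (neg_lt_iff_pos_add.1 hx).le,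
      ofReal_im]
  | succ n ih =>
    have hper (y : ℝ) (hy : -1 < y) : imCLM (logMultipleGamma (n + 1) (y + 1 : ℝ)) =
        imCLM (logMultipleGamma (n + 1) y) := by
      rw [ofReal_add, ofReal_one, logMultipleGamma_add_one n (ofReal_add_one_mem_slitPlane hy),
        map_add, imCLM_apply (logMultipleGamma n y), ih hy, add_zero]
    have hconst := eq_of_periodic_of_le_iteratedDeriv
      (contDiffOn_clm_logMultipleGamma imCLM (n + 1)) hper
      (tendsto_iteratedDeriv_clm_logMultipleGamma imCLM (Nat.lt_succ_self (n + 1)))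
      (.of_forall fun _ => le_rfl) hx neg_one_lt_zero
    rwa [ofReal_zero, logMultipleGamma_zero_right, map_zero] at hconst

theorem logMultipleGamma_ofReal (n : ℕ) {x : ℝ} (hx : -1 < x) :
    ((logMultipleGamma n x).re : ℂ) = logMultipleGamma n x :=
  Complex.ext (by simp) (by simp [logMultipleGamma_im n hx])

/-! ### Continuation along a functional equation -/

/-- The complement of `ℤ_{≤ 0}`, on which the multiple gamma functions are holomorphic; the
condition is written as in `IsMultipleGammaHierarchy`. -/
def nonposIntCompl : Set ℂ := {z : ℂ | ∀ m : ℕ, z ≠ -(m : ℂ)}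

theorem isOpen_nonposIntCompl : IsOpen nonposIntCompl := by
  have hrange : nonposIntCompl = (((↑) : ℤ → ℂ) '' Set.range fun m : ℕ => -(m : ℤ))ᶜ := by
    ext z
    simp [nonposIntCompl, eq_comm]
  rw [hrange, isOpen_compl_iff]
  exact isClosedEmbedding_intCast.isClosedMap _ (isClosed_discrete _)

theorem slitPlane_subset_nonposIntCompl : slitPlane ⊆ nonposIntCompl := by
  rintro _ hz m rfl
  simp [mem_slitPlane_iff, m.cast_nonneg.not_gt] at hz

theorem add_natCast_mem_nonposIntCompl {z : ℂ} (hz : z ∈ nonposIntCompl) (n : ℕ) :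
    z + n ∈ nonposIntCompl := by
  intro m h
  refine hz (m + n) ?_
  rw [Nat.cast_add, neg_add]
  exact eq_add_neg_of_add_eq h

/-- The value at `z` forced by `E (z + N)` and the functional equation `E (w + 1) = g w * E w`. -/
noncomputable def shiftQuotient (E g : ℂ → ℂ) (N : ℕ) (z : ℂ) : ℂ :=
  E (z + N) / ∏ i ∈ range N, g (z + i)

/-- The continuation of a function `E` on the right half-plane to `nonposIntCompl` by means of
`E (w + 1) = g w * E w`. The number of steps is chosen arbitrarily among those that lead into the
half-plane. -/
noncomputable def extendLeft (E g : ℂ → ℂ) (z : ℂ) : ℂ :=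
  shiftQuotient E g (exists_nat_re_add_pos z).choose z

section ExtendLeft

variable {E g : ℂ → ℂ}

theorem prod_add_natCast_ne_zero (hg0 : ∀ z ∈ nonposIntCompl, g z ≠ 0) (N : ℕ) {z : ℂ}
    (hz : z ∈ nonposIntCompl) : ∏ i ∈ range N, g (z + i) ≠ 0 :=
  prod_ne_zero_iff.2 fun i _ => hg0 _ (add_natCast_mem_nonposIntCompl hz i)

theorem shiftQuotient_add (hg0 : ∀ z ∈ nonposIntCompl, g z ≠ 0)
    (hE : ∀ z : ℂ, 0 < z.re → E (z + 1) = g z * E z) {N : ℕ} {z : ℂ} (hz : z ∈ nonposIntCompl)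
    (hN : 0 < (z + N).re) (d : ℕ) : shiftQuotient E g (N + d) z = shiftQuotient E g N z := by
  induction d with
  | zero => rfl
  | succ d ih =>
    have hpos : 0 < (z + (N + d : ℕ)).re := by
      rw [Nat.cast_add, ← add_assoc, add_re _ (d : ℂ), natCast_re]
      exact add_pos_of_pos_of_nonneg hN d.cast_nonneg
    rw [← ih, shiftQuotient, shiftQuotient, ← add_assoc N, prod_range_succ, Nat.cast_succ,
      ← add_assoc z, hE _ hpos, mul_comm (g _)]
    exact mul_div_mul_right _ _ (hg0 _ (add_natCast_mem_nonposIntCompl hz _))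

theorem shiftQuotient_apply_add_one {z : ℂ} (hz : g z ≠ 0) (N : ℕ) :
    shiftQuotient E g N (z + 1) = g z * shiftQuotient E g (N + 1) z := by
  have hprod : ∏ i ∈ range N, g (z + (i + 1 : ℕ)) = ∏ i ∈ range N, g (z + 1 + i) :=
    prod_congr rfl fun i _ => by rw [Nat.cast_succ, add_assoc, add_comm (i : ℂ)]
  rw [shiftQuotient, shiftQuotient, prod_range_succ', Nat.cast_zero, add_zero, hprod,
    mul_comm _ (g z), ← mul_div_assoc, mul_div_mul_left _ _ hz, Nat.cast_succ,
    add_assoc, add_comm (1 : ℂ)]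

theorem extendLeft_eq_shiftQuotient (hg0 : ∀ z ∈ nonposIntCompl, g z ≠ 0)
    (hE : ∀ z : ℂ, 0 < z.re → E (z + 1) = g z * E z) {N : ℕ} {z : ℂ} (hz : z ∈ nonposIntCompl)
    (hN : 0 < (z + N).re) : extendLeft E g z = shiftQuotient E g N z := by
  have hchoose := (exists_nat_re_add_pos z).choose_spec
  rw [extendLeft, ← shiftQuotient_add hg0 hE hz hN, ← shiftQuotient_add hg0 hE hz hchoose N,
    add_comm]

theorem extendLeft_of_re_pos (hg0 : ∀ z ∈ nonposIntCompl, g z ≠ 0)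
    (hE : ∀ z : ℂ, 0 < z.re → E (z + 1) = g z * E z) {z : ℂ} (hz : 0 < z.re) :
    extendLeft E g z = E z := by
  have hmem := slitPlane_subset_nonposIntCompl (mem_slitPlane_of_re_pos hz)
  rw [extendLeft_eq_shiftQuotient (N := 0) hg0 hE hmem (by simpa using hz)]
  simp [shiftQuotient]

theorem extendLeft_add_one (hg0 : ∀ z ∈ nonposIntCompl, g z ≠ 0)
    (hE : ∀ z : ℂ, 0 < z.re → E (z + 1) = g z * E z) {z : ℂ} (hz : z ∈ nonposIntCompl) :
    extendLeft E g (z + 1) = g z * extendLeft E g z := by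
  obtain ⟨N, hN⟩ := exists_nat_re_add_pos z
  have hN1 : 0 < (z + 1 + N).re := by
    rw [add_right_comm, add_re, one_re]
    exact add_pos hN one_pos
  have hmem : z + 1 ∈ nonposIntCompl := by simpa using add_natCast_mem_nonposIntCompl hz 1
  rw [extendLeft_eq_shiftQuotient hg0 hE hmem hN1, shiftQuotient_apply_add_one (hg0 z hz),
    shiftQuotient_add hg0 hE hz hN, extendLeft_eq_shiftQuotient hg0 hE hz hN]

theorem extendLeft_ne_zero (hg0 : ∀ z ∈ nonposIntCompl, g z ≠ 0)
    (hE0 : ∀ z : ℂ, 0 < z.re → E z ≠ 0) {z : ℂ} (hz : z ∈ nonposIntCompl) :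
    extendLeft E g z ≠ 0 :=
  div_ne_zero (hE0 _ (exists_nat_re_add_pos z).choose_spec) (prod_add_natCast_ne_zero hg0 _ hz)

theorem differentiableOn_extendLeft (hg : DifferentiableOn ℂ g nonposIntCompl)
    (hg0 : ∀ z ∈ nonposIntCompl, g z ≠ 0) (hE : ∀ z : ℂ, 0 < z.re → E (z + 1) = g z * E z)
    (hEd : ∀ z : ℂ, 0 < z.re → DifferentiableAt ℂ E z) :
    DifferentiableOn ℂ (extendLeft E g) nonposIntCompl := by
  intro z hz
  obtain ⟨N, hN⟩ := exists_nat_re_add_pos z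
  have hloc : extendLeft E g =ᶠ[𝓝 z] shiftQuotient E g N := by
    have hopen : IsOpen {w : ℂ | 0 < (w + N).re} :=
      isOpen_lt continuous_const (continuous_re.comp (continuous_add_const _))
    filter_upwards [isOpen_nonposIntCompl.mem_nhds hz, hopen.mem_nhds hN] with w hw hwN
      using extendLeft_eq_shiftQuotient hg0 hE hw hwN
  refine (DifferentiableAt.congr_of_eventuallyEq ?_ hloc).differentiableWithinAt
  refine (differentiableAt_comp_add_const.2 (hEd _ hN)).fun_div
    (DifferentiableAt.fun_finsetProd fun i _ => ?_) (prod_add_natCast_ne_zero hg0 N hz)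
  exact differentiableAt_comp_add_const.2 (hg.differentiableAt
    (isOpen_nonposIntCompl.mem_nhds (add_natCast_mem_nonposIntCompl hz i)))

end ExtendLeft

/-! ### Existence of the multiple gamma functions -/

theorem differentiableAt_exp_logMultipleGamma (n : ℕ) {z : ℂ} (hz : z ∈ slitPlane) :
    DifferentiableAt ℂ (fun z => exp (logMultipleGamma n (z - 1))) z :=
  (differentiableAt_comp_sub_const.2
    (analyticAt_logMultipleGamma n (by rwa [sub_add_cancel])).differentiableAt).cexp

theorem exp_logMultipleGamma_add_one (n : ℕ) {z : ℂ} (hz : z ∈ slitPlane) :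
    exp (logMultipleGamma (n + 1) (z + 1 - 1)) =
      exp (logMultipleGamma n (z - 1)) * exp (logMultipleGamma (n + 1) (z - 1)) := by
  rw [add_sub_right_comm, logMultipleGamma_add_one n (by rwa [sub_add_cancel]), exp_add, mul_comm]

theorem exp_logMultipleGamma_zero {z : ℂ} (hz : z ≠ 0) : exp (logMultipleGamma 0 (z - 1)) = z := by
  rw [logMultipleGamma, sub_add_cancel, exp_log hz]

/-- The Vignéras multiple gamma functions `G_n`; the value at a non-positive integer is junk unless
`n = 0`. -/
noncomputable def multipleGamma : ℕ → ℂ → ℂ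
  | 0 => id
  | n + 1 => extendLeft (fun z => exp (logMultipleGamma (n + 1) (z - 1))) (multipleGamma n)

theorem multipleGamma_ne_zero (n : ℕ) {z : ℂ} (hz : z ∈ nonposIntCompl) :
    multipleGamma n z ≠ 0 := by
  induction n generalizing z with
  | zero => simpa [multipleGamma] using hz 0
  | succ n ih => exact extendLeft_ne_zero (fun _ => ih) (fun _ _ => exp_ne_zero _) hz

theorem multipleGamma_of_re_pos (n : ℕ) {z : ℂ} (hz : 0 < z.re) :
    multipleGamma n z = exp (logMultipleGamma n (z - 1)) := by
  induction n generalizing z with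
  | zero => exact (exp_logMultipleGamma_zero (slitPlane_ne_zero (mem_slitPlane_of_re_pos hz))).symm
  | succ n ih =>
    refine extendLeft_of_re_pos (fun _ => multipleGamma_ne_zero n) (fun w hw => ?_) hz
    rw [ih hw, exp_logMultipleGamma_add_one n (mem_slitPlane_of_re_pos hw)]

theorem exp_logMultipleGamma_add_one_of_re_pos (n : ℕ) (z : ℂ) (hz : 0 < z.re) :
    exp (logMultipleGamma (n + 1) (z + 1 - 1)) =
      multipleGamma n z * exp (logMultipleGamma (n + 1) (z - 1)) := by
  rw [multipleGamma_of_re_pos n hz, exp_logMultipleGamma_add_one n (mem_slitPlane_of_re_pos hz)]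

theorem multipleGamma_add_one (n : ℕ) {z : ℂ} (hz : z ∈ nonposIntCompl) :
    multipleGamma (n + 1) (z + 1) = multipleGamma n z * multipleGamma (n + 1) z :=
  extendLeft_add_one (fun _ => multipleGamma_ne_zero n)
    (exp_logMultipleGamma_add_one_of_re_pos n) hz

theorem differentiableOn_multipleGamma (n : ℕ) :
    DifferentiableOn ℂ (multipleGamma n) nonposIntCompl := by
  induction n with
  | zero => exact differentiableOn_id
  | succ n ih =>
    exact differentiableOn_extendLeft ih (fun _ => multipleGamma_ne_zero n)
      (exp_logMultipleGamma_add_one_of_re_pos n)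
      fun _ hw => differentiableAt_exp_logMultipleGamma (n + 1) (mem_slitPlane_of_re_pos hw)

theorem multipleGamma_ofReal_add_one (n : ℕ) {x : ℝ} (hx : -1 < x) :
    multipleGamma n (x + 1) = (Real.exp (logMultipleGamma n x).re : ℝ) := by
  have hpos : 0 < ((x : ℂ) + 1).re := neg_lt_iff_pos_add.1 hx
  rw [multipleGamma_of_re_pos n hpos, add_sub_cancel_right, ofReal_exp,
    logMultipleGamma_ofReal n hx]

theorem iteratedDeriv_log_multipleGamma_nonneg (n : ℕ) {x : ℝ} (hx : -1 < x) :
    0 ≤ iteratedDeriv (n + 1) (fun t : ℝ => Real.log (multipleGamma n (t + 1)).re) x := by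
  have hloc : (fun t : ℝ => Real.log (multipleGamma n (t + 1)).re) =ᶠ[𝓝 x]
      fun t : ℝ => (logMultipleGamma n t).re := by
    filter_upwards [lt_mem_nhds hx] with t ht
    rw [multipleGamma_ofReal_add_one n ht, ofReal_re, Real.log_exp]
  have hsign := neg_one_pow_mul_iteratedDeriv_logMultipleGamma_nonneg n n.lt_succ_self hx
  have heven : Even (n + 1 + n + 1) := ⟨n + 1, by ring⟩
  rwa [heven.neg_one_pow, one_mul, ← hloc.iteratedDeriv_eq] at hsign

theorem isMultipleGammaHierarchy_multipleGamma : IsMultipleGammaHierarchy multipleGamma where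
  differentiableOn := differentiableOn_multipleGamma
  pos n x hx := ⟨_, Real.exp_pos _, multipleGamma_ofReal_add_one n (neg_one_lt_zero.trans_le hx)⟩
  add_one n _ hz := multipleGamma_add_one n hz
  one n := by
    rw [multipleGamma_of_re_pos n (by simp), sub_self, logMultipleGamma_zero_right, exp_zero]
  iteratedDeriv_nonneg n _ hx :=
    iteratedDeriv_log_multipleGamma_nonneg n (neg_one_lt_zero.trans_le hx)
  zero _ := rfl

/-! ### Uniqueness of the multiple gamma functions -/

theorem isPreconnected_slitPlane : IsPreconnected slitPlane :=
  (starConvex_one_slitPlane.isPathConnected (by simp)).isConnected.isPreconnected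

theorem eqOn_slitPlane_of_eq_ofReal {f g : ℂ → ℂ} (hf : DifferentiableOn ℂ f slitPlane)
    (hg : DifferentiableOn ℂ g slitPlane) (hfg : ∀ x : ℝ, 1 ≤ x → f x = g x) :
    Set.EqOn f g slitPlane := by
  have htwo : ((2 : ℝ) : ℂ) ∈ slitPlane := ofReal_mem_slitPlane.2 two_pos
  refine (hf.analyticOnNhd isOpen_slitPlane).eqOn_of_preconnected_of_frequently_eq
    (hg.analyticOnNhd isOpen_slitPlane) isPreconnected_slitPlane htwo ?_
  have hreal : Tendsto ((↑) : ℝ → ℂ) (𝓝[≠] 2) (𝓝[≠] ((2 : ℝ) : ℂ)) :=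
    continuous_ofReal.continuousWithinAt.tendsto_nhdsWithin fun _ hx => ofReal_injective.ne hx
  refine hreal.frequently (Eventually.frequently ?_)
  filter_upwards [nhdsWithin_le_nhds (Ici_mem_nhds one_lt_two)] with x hx using hfg x hx

namespace IsMultipleGammaHierarchy

variable {G : ℕ → ℂ → ℂ} (hG : IsMultipleGammaHierarchy G)
include hG

theorem re_pos (n : ℕ) {x : ℝ} (hx : 0 ≤ x) : 0 < (G n (x + 1)).re := by
  obtain ⟨r, hr, hGr⟩ := hG.pos n x hx
  rwa [hGr]

theorem ofReal_re_eq (n : ℕ) {x : ℝ} (hx : 0 ≤ x) : ((G n (x + 1)).re : ℂ) = G n (x + 1) := by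
  obtain ⟨r, -, hGr⟩ := hG.pos n x hx
  rw [hGr, ofReal_re]

theorem contDiffAt_log_re (n : ℕ) {x : ℝ} (hx : 0 ≤ x) {m : WithTop ℕ∞} :
    ContDiffAt ℝ m (fun t : ℝ => Real.log (G n (t + 1)).re) x := by
  have hmem : (x : ℂ) + 1 ∈ nonposIntCompl := slitPlane_subset_nonposIntCompl
    (ofReal_add_one_mem_slitPlane (neg_one_lt_zero.trans_le hx))
  have hshift : AnalyticAt ℂ (fun z => G n (z + 1)) x :=
    ((hG.differentiableOn n).analyticAt (isOpen_nonposIntCompl.mem_nhds hmem)).comp_of_eq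
      (analyticAt_id.add analyticAt_const) rfl
  exact (contDiffAt_clm_comp_ofReal reCLM hshift).log (hG.re_pos n hx).ne'

theorem log_re_add_one (n : ℕ) {x : ℝ} (hx : 0 ≤ x) :
    Real.log (G (n + 1) (x + 1 + 1)).re =
      Real.log (G (n + 1) (x + 1)).re + Real.log (G n (x + 1)).re := by
  have hmem : (x : ℂ) + 1 ∈ nonposIntCompl := slitPlane_subset_nonposIntCompl
    (ofReal_add_one_mem_slitPlane (neg_one_lt_zero.trans_le hx))
  rw [hG.add_one n _ hmem, ← hG.ofReal_re_eq n hx, re_ofReal_mul, ofReal_re,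
    Real.log_mul (hG.re_pos n hx).ne' (hG.re_pos (n + 1) hx).ne', add_comm]

theorem neg_iteratedDeriv_le_iteratedDeriv_log_sub (n : ℕ) {x : ℝ} (hx : 0 ≤ x) :
    -iteratedDeriv (n + 1) (fun t : ℝ => (logMultipleGamma n t).re) x ≤
      iteratedDeriv (n + 1)
        (fun t : ℝ => Real.log (G n (t + 1)).re - (logMultipleGamma n t).re) x := by
  have hmem := ofReal_add_one_mem_slitPlane (neg_one_lt_zero.trans_le hx)
  have hcontDiff : ContDiffAt ℝ (n + 1 : ℕ) (fun t : ℝ => (logMultipleGamma n t).re) x :=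
    contDiffAt_clm_comp_ofReal reCLM (analyticAt_logMultipleGamma n hmem)
  rw [iteratedDeriv_fun_sub (hG.contDiffAt_log_re n hx) hcontDiff]
  exact neg_le_sub_iff_le_add.2 (le_add_of_nonneg_left (hG.iteratedDeriv_nonneg n x hx))

theorem log_re_eq (n : ℕ) {x : ℝ} (hx : 0 ≤ x) :
    Real.log (G n (x + 1)).re = (logMultipleGamma n x).re := by
  induction n generalizing x with
  | zero =>
    rw [hG.zero, logMultipleGamma, ← ofReal_one, ← ofReal_add, ofReal_re, log_ofReal_re]
  | succ n ih =>
    set f : ℝ → ℝ := fun t => Real.log (G (n + 1) (t + 1)).re - (logMultipleGamma (n + 1) t).re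
      with hf
    have hzero : f 0 = 0 := by simp [hf, hG.one, logMultipleGamma_zero_right]
    have hper (t : ℝ) (ht : 0 ≤ t) : f (t + 1) = f t := by
      have hmem := ofReal_add_one_mem_slitPlane (neg_one_lt_zero.trans_le ht)
      simp only [hf]
      rw [ofReal_add, ofReal_one, hG.log_re_add_one n ht, logMultipleGamma_add_one n hmem, add_re,
        ih ht, add_sub_add_right_eq_sub]
    have hcontDiff : ContDiffOn ℝ ((n + 1 : ℕ) + 1) f (Set.Ioi 0) := fun t ht =>
      (hG.contDiffAt_log_re (n + 1) (le_of_lt ht)).contDiffWithinAt.sub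
        ((contDiffOn_clm_logMultipleGamma reCLM (n + 1)).mono
          (Set.Ioi_subset_Ioi neg_one_lt_zero.le) t ht)
    have hlim := (tendsto_iteratedDeriv_clm_logMultipleGamma reCLM (n + 1).lt_succ_self).neg
    rw [neg_zero] at hlim
    have hle := (eventually_ge_atTop 0).mono fun t ht =>
      hG.neg_iteratedDeriv_le_iteratedDeriv_log_sub (n + 1) ht
    have hfx : f x = 0 := by
      rcases hx.eq_or_lt with rfl | hx
      · exact hzero
      · rw [eq_of_periodic_of_le_iteratedDeriv hcontDiff (fun t ht => hper t (le_of_lt ht)) hlim hle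
          hx (zero_lt_one' ℝ), ← zero_add 1, hper 0 le_rfl, hzero]
    exact sub_eq_zero.1 hfx

theorem eqOn_exp_logMultipleGamma (n : ℕ) :
    Set.EqOn (G n) (fun z => exp (logMultipleGamma n (z - 1))) slitPlane := by
  refine eqOn_slitPlane_of_eq_ofReal
    ((hG.differentiableOn n).mono slitPlane_subset_nonposIntCompl)
    (fun z hz => (differentiableAt_exp_logMultipleGamma n hz).differentiableWithinAt)
    fun x hx => ?_
  obtain ⟨t, ht, rfl⟩ : ∃ t : ℝ, 0 ≤ t ∧ x = t + 1 :=
    ⟨x - 1, sub_nonneg.2 hx, (sub_add_cancel x 1).symm⟩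
  rw [ofReal_add, ofReal_one, add_sub_cancel_right, ← hG.ofReal_re_eq n ht,
    ← Real.exp_log (hG.re_pos n ht), hG.log_re_eq n ht, ofReal_exp,
    logMultipleGamma_ofReal n (neg_one_lt_zero.trans_le ht)]

end IsMultipleGammaHierarchy

/-! ### The branch of the logarithm -/

theorem isPreconnected_add_one_mem_slitPlane : IsPreconnected {z : ℂ | z + 1 ∈ slitPlane} := by
  have himage : {z : ℂ | z + 1 ∈ slitPlane} = (· - 1) '' slitPlane := by
    ext z
    simp [sub_eq_iff_eq_add]
  rw [himage]
  exact isPreconnected_slitPlane.image _ (by fun_prop)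

theorem IsLogBranch.eqOn {g L₁ L₂ : ℂ → ℂ} (h₁ : IsLogBranch g L₁) (h₂ : IsLogBranch g L₂) :
    Set.EqOn L₁ L₂ {z | z + 1 ∈ slitPlane} := by
  have hzero : (0 : ℂ) ∈ {z : ℂ | z + 1 ∈ slitPlane} := by simp
  exact isCoveringMap_exp.eqOn_of_comp_eqOn isPreconnected_add_one_mem_slitPlane
    h₁.differentiableOn.continuousOn h₂.differentiableOn.continuousOn
    (fun z hz => Subtype.ext ((h₁.exp_eq z hz).trans (h₂.exp_eq z hz).symm)) hzero
    (h₁.zero.trans h₂.zero.symm)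

theorem IsMultipleGammaHierarchy.isLogBranch {G : ℕ → ℂ → ℂ} (hG : IsMultipleGammaHierarchy G)
    (n : ℕ) : IsLogBranch (G n) (logMultipleGamma n) where
  differentiableOn := differentiableOn_logMultipleGamma n
  exp_eq z hz := by simp only [hG.eqOn_exp_logMultipleGamma n hz, add_sub_cancel_right]
  zero := logMultipleGamma_zero_right n

theorem proposition5p2 :
    (∀ (j : ℕ) (z : ℂ), z + 1 ∈ Complex.slitPlane →
      Summable fun k : ℕ => ‖kTerm j z (k + 1)‖) ∧
    (∃ G : ℕ → ℂ → ℂ, IsMultipleGammaHierarchy G) ∧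
    ∀ G : ℕ → ℂ → ℂ, IsMultipleGammaHierarchy G → ∀ n : ℕ, 1 ≤ n →
      (∃ L : ℂ → ℂ, IsLogBranch (G n) L) ∧
      ∀ L : ℂ → ℂ, IsLogBranch (G n) L → ∀ z : ℂ, z + 1 ∈ Complex.slitPlane →
        L z = ∑ j ∈ Finset.range n, binomCoeffPoly n j z * funK j z := by
  refine ⟨fun j z _ => summable_norm_kTerm j z, ⟨_, isMultipleGammaHierarchy_multipleGamma⟩,
    fun G hG n hn => ⟨⟨_, hG.isLogBranch n⟩, fun L hL z hz => ?_⟩⟩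
  obtain ⟨m, rfl⟩ := Nat.exists_eq_add_of_le' hn
  exact hL.eqOn (hG.isLogBranch (m + 1)) hz
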